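/- Let $\mathcal H=L^2(\mathbb R;\mathbb C)$, with $Q$ the multiplication by $x$ and $P=-i\,\frac{d}{dx}$, and let $W(q,p)=e^{iqp/2}e^{-iqP}e^{ipQ}$ be the Weyl operators, so that $(e^{-iqP}\psi)(x)=\psi(x-q)$ and $(e^{ipQ}\psi)(x)=e^{ipx}\psi(x)$. A state is a positive operator on $\mathcal H$ with trace one. An observable is a normalized positive operator measure $\mathsf E:\mathcal B(\mathbb R^2)\to\mathcal L(\mathcal H)$ on the Borel sets of $\mathbb R^2$. Its statistics in a state $\rho$ are $\mathsf E_\rho(Z)=\operatorname{tr}[\rho\,\mathsf E(Z)]$. Two observables $\mathsf E,\mathsf F$ are informationally equivalent if, for all states $\rho_1,\rho_2$, $\mathsf E_{\rho_1}=\mathsf E_{\rho_2}$ if and only if $\mathsf F_{\rho_1}=\mathsf F_{\rho_2}$; $\mathsf E$ is informationally complete if, for all states $\rho_1,\rho_2$, $\mathsf E_{\rho_1}=\mathsf E_{\rho_2}$ implies $\rho_1=\rho_2$. Let $\theta\in(-\pi,0)\cup(0,\pi)$, let $f_\theta:\mathbb R^2\to\mathbb R^2$ be the linear bijection $f_\theta(q,p)=(q,\,q\cos\theta+p\sin\theta)$,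 and put $W_\theta(q,p)=W(f_\theta^{-1}(q,p))$. Let $S$ be a positive operator on $\mathcal H$ with trace one, and for Borel sets $Z\subseteq\mathbb R^2$ put $$\mathsf G^S(Z)=\frac1{2\pi}\int_Z W(q,p)\,S\,W(q,p)^*\,dq\,dp,\qquad \mathsf G^S_\theta(Z)=\frac1{2\pi|\sin\theta|}\int_Z W_\theta(q,p)\,S\,W_\theta(q,p)^*\,dq\,dp .$$ Then these integrals exist in the weak sense (every matrix element of the integrand is integrable over $Z$, and the integrals of the matrix elements are those of a bounded operator), $\mathsf G^S$ and $\mathsf G^S_\theta$ are observables, and $$\mathsf G^S_\theta(Z)=\mathsf G^S(f_\theta^{-1}(Z))\qquad\text{for every Borel set } Z\subseteq\mathbb R^2 .$$ Moreover, $\mathsf G^S$ and $\mathsf G^S_\theta$ are informationally equivalent, and $\mathsf G^S_\theta$ is informationally complete if and only if the support of the function $(q,p)\mapsto\operatorname{tr}[S\,W(q,p)]$ (the closure of the set where it does not vanish) is all of $\mathbb R^2$. -/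

import Mathlib

open MeasureTheory

noncomputable section

namespace TiltedPhaseSpace

/-- The Hilbert space `L²(ℝ; ℂ)` of one mode, in the coordinate representation. -/
abbrev H : Type := Lp ℂ 2 (volume : Measure ℝ)

/-! ### Trace, states -/

/-- The index set of a fixed orthonormal (Hilbert) basis of `H`. -/
def basisIndex : Set H := Classical.choose (exists_hilbertBasis ℂ H)

/-- A fixed orthonormal (Hilbert) basis of `H`. -/
def basis : HilbertBasis basisIndex ℂ H :=
  Classical.choose (Classical.choose_spec (exists_hilbertBasis ℂ H))

/-- The trace `∑ₙ ⟨eₙ, A eₙ⟩`. It is meant for trace class operators, where the series converges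
absolutely and its sum does not depend on the orthonormal basis. -/
def tr (A : H →L[ℂ] H) : ℂ := ∑' i, inner ℂ (basis i) (A (basis i))

/-- States: positive operators with unit trace. (The sum of a divergent series is `0` by
convention, so `tr ρ = 1` includes convergence, i.e. that the positive operator `ρ` is trace
class.) -/
def IsState (ρ : H →L[ℂ] H) : Prop := ρ.IsPositive ∧ tr ρ = 1

/-! ### Observables with outcome space `ℝ²` -/

/-- Normalized positive operator measures on the Borel sets of `ℝ²`. Values on sets that are not
Borel play no role. -/
structure IsObservable (E : Set (ℝ × ℝ) → (H →L[ℂ] H)) : Prop where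
  isPositive : ∀ Z, MeasurableSet Z → (E Z).IsPositive
  univ : E Set.univ = 1
  iUnion : ∀ Z : ℕ → Set (ℝ × ℝ), (∀ n, MeasurableSet (Z n)) →
    Pairwise (Function.onFun Disjoint Z) → ∀ φ ψ : H,
      HasSum (fun n => inner ℂ φ (E (Z n) ψ)) (inner ℂ φ (E (⋃ n, Z n) ψ))

/-- `E_ρ₁ = E_ρ₂`, where `E_ρ(Z) = tr[ρ E(Z)]`: the states `ρ₁` and `ρ₂` give the same measurement
outcome statistics for `E`. -/
def SameStatistics (E : Set (ℝ × ℝ) → (H →L[ℂ] H)) (ρ₁ ρ₂ : H →L[ℂ] H) : Prop :=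
  ∀ Z, MeasurableSet Z → tr (ρ₁ * E Z) = tr (ρ₂ * E Z)

/-- `E` and `F` distinguish exactly the same states. -/
def InformationallyEquivalent (E F : Set (ℝ × ℝ) → (H →L[ℂ] H)) : Prop :=
  ∀ ρ₁ ρ₂, IsState ρ₁ → IsState ρ₂ → (SameStatistics E ρ₁ ρ₂ ↔ SameStatistics F ρ₁ ρ₂)

/-- The measurement outcome statistics of `E` determine the state uniquely. -/
def InformationallyComplete (E : Set (ℝ × ℝ) → (H →L[ℂ] H)) : Prop :=
  ∀ ρ₁ ρ₂, IsState ρ₁ → IsState ρ₂ → SameStatistics E ρ₁ ρ₂ → ρ₁ = ρ₂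

/-! ### Weyl operators -/

/-- `e^{-iqP}`, where `P = -i d/dx`: the translation `(e^{-iqP} ψ)(x) = ψ(x - q)`. -/
def translation (q : ℝ) : H →L[ℂ] H :=
  (Lp.compMeasurePreservingₗᵢ ℂ (fun x : ℝ => x - q)
    (measurePreserving_sub_right volume q)).toContinuousLinearMap

theorem memLp_modulation (p : ℝ) (ψ : H) :
    MemLp (fun x : ℝ => Complex.exp (Complex.I * p * x) * ψ x) 2 volume := by
  refine (Lp.memLp ψ).of_le ?_ (Filter.Eventually.of_forall fun x => ?_)
  · exact (Continuous.aestronglyMeasurable (by fun_prop)).mul (Lp.aestronglyMeasurable ψ)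
  · rw [norm_mul, mul_assoc, ← Complex.ofReal_mul, mul_comm Complex.I,
      Complex.norm_exp_ofReal_mul_I, one_mul]

/-- `e^{ipQ}`: the multiplication operator `(e^{ipQ} ψ)(x) = e^{ipx} ψ(x)`. -/
def modulation (p : ℝ) : H →L[ℂ] H :=
  LinearMap.mkContinuous
    { toFun := fun ψ => (memLp_modulation p ψ).toLp _
      map_add' := fun ψ φ => by
        rw [← MemLp.toLp_add]
        refine MemLp.toLp_congr _ _ ?_
        filter_upwards [Lp.coeFn_add ψ φ] with x hx
        rw [Pi.add_apply, hx, Pi.add_apply, mul_add]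
      map_smul' := fun c ψ => by
        rw [RingHom.id_apply, ← MemLp.toLp_const_smul]
        refine MemLp.toLp_congr _ _ ?_
        filter_upwards [Lp.coeFn_smul c ψ] with x hx
        simp [hx, mul_left_comm] }
    1
    (fun ψ => by
      rw [one_mul]
      refine Lp.norm_le_norm_of_ae_le ?_
      filter_upwards [MemLp.coeFn_toLp (memLp_modulation p ψ)] with x hx
      refine (congrArg norm hx).le.trans ?_
      rw [norm_mul, mul_assoc, ← Complex.ofReal_mul, mul_comm Complex.I,
        Complex.norm_exp_ofReal_mul_I, one_mul])

/-- The Weyl operator `W(q,p) = e^{iqp/2} e^{-iqP} e^{ipQ}`. -/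
def weyl (x : ℝ × ℝ) : H →L[ℂ] H :=
  Complex.exp (Complex.I * (x.1 * x.2 / 2)) • (translation x.1 * modulation x.2)

/-! ### The tilting map and the tilted Weyl operators -/

theorem sin_ne_zero {θ : ℝ} (hθ : θ ∈ Set.Ioo (-Real.pi) 0 ∪ Set.Ioo 0 Real.pi) :
    Real.sin θ ≠ 0 := by
  rcases hθ with h | h
  · exact (Real.sin_neg_of_neg_of_neg_pi_lt h.2 h.1).ne
  · exact (Real.sin_pos_of_pos_of_lt_pi h.1 h.2).ne'

/-- The linear bijection `f_θ(q,p) = (q, q cos θ + p sin θ)` of `ℝ²`. -/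
def tilt (θ : ℝ) (hθ : θ ∈ Set.Ioo (-Real.pi) 0 ∪ Set.Ioo 0 Real.pi) :
    (ℝ × ℝ) ≃ₗ[ℝ] (ℝ × ℝ) where
  toFun x := (x.1, x.1 * Real.cos θ + x.2 * Real.sin θ)
  map_add' x y := by ext <;> simp; ring
  map_smul' c x := by ext <;> simp; ring
  invFun y := (y.1, (y.2 - y.1 * Real.cos θ) / Real.sin θ)
  left_inv x := by
    have := sin_ne_zero hθ
    ext <;> simp [this]
  right_inv y := by
    have := sin_ne_zero hθ
    ext <;> simp [this]

/-- `W_θ(q,p) = W(f_θ⁻¹(q,p))`. -/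
def tiltedWeyl (θ : ℝ) (hθ : θ ∈ Set.Ioo (-Real.pi) 0 ∪ Set.Ioo 0 Real.pi) (x : ℝ × ℝ) :
    H →L[ℂ] H :=
  weyl ((tilt θ hθ).symm x)

/-! ### Operator integrals and the observables -/

/-- `T = ∫_Z F(q,p) dq dp` in the weak sense: every matrix element of `F` is integrable over `Z`,
and its integral is the matrix element of `T`. -/
def HasWeakIntegral (F : ℝ × ℝ → (H →L[ℂ] H)) (Z : Set (ℝ × ℝ)) (T : H →L[ℂ] H) : Prop :=
  ∀ φ ψ : H, IntegrableOn (fun x => inner ℂ φ (F x ψ)) Z volume ∧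
    inner ℂ φ (T ψ) = ∫ x in Z, inner ℂ φ (F x ψ)

open Classical in
/-- The weak integral `∫_Z F(q,p) dq dp` (there is at most one); `0` if it does not exist. -/
def weakIntegral (F : ℝ × ℝ → (H →L[ℂ] H)) (Z : Set (ℝ × ℝ)) : H →L[ℂ] H :=
  if h : ∃ T, HasWeakIntegral F Z T then Classical.choose h else 0

/-- The integrand `W(q,p) S W(q,p)^*` of `G^S`. -/
def orbit (S : H →L[ℂ] H) (x : ℝ × ℝ) : H →L[ℂ] H :=
  weyl x * S * ContinuousLinearMap.adjoint (weyl x)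

/-- The integrand `W_θ(q,p) S W_θ(q,p)^*` of `G^S_θ`. -/
def tiltedOrbit (θ : ℝ) (hθ : θ ∈ Set.Ioo (-Real.pi) 0 ∪ Set.Ioo 0 Real.pi) (S : H →L[ℂ] H)
    (x : ℝ × ℝ) : H →L[ℂ] H :=
  tiltedWeyl θ hθ x * S * ContinuousLinearMap.adjoint (tiltedWeyl θ hθ x)

/-- `G^S(Z) = (1 / 2π) ∫_Z W(q,p) S W(q,p)^* dq dp`. -/
def G (S : H →L[ℂ] H) (Z : Set (ℝ × ℝ)) : H →L[ℂ] H :=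
  ((1 / (2 * Real.pi) : ℝ) : ℂ) • weakIntegral (orbit S) Z

/-- `G^S_θ(Z) = (1 / (2π |sin θ|)) ∫_Z W_θ(q,p) S W_θ(q,p)^* dq dp`. -/
def tiltedG (θ : ℝ) (hθ : θ ∈ Set.Ioo (-Real.pi) 0 ∪ Set.Ioo 0 Real.pi) (S : H →L[ℂ] H)
    (Z : Set (ℝ × ℝ)) : H →L[ℂ] H :=
  ((1 / (2 * Real.pi * |Real.sin θ|) : ℝ) : ℂ) • weakIntegral (tiltedOrbit θ hθ S) Z

end TiltedPhaseSpace

end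

noncomputable section

namespace TiltedPhaseSpace

open Complex ComplexConjugate
open scoped ComplexOrder

/-! ### Decomposition of states into vectors -/

/-! Writing a state as `∑ᵢ |rᵢ⟩⟨rᵢ|` with `∑ ‖rᵢ‖² = 1` reduces everything to the matrix
coefficients `⟨φ, W(x)χ⟩`. By Plancherel these are square integrable and satisfy the orthogonality
relations `integral_inner_weyl_mul`, which give existence and normalization of the weak integrals.
The tilted observable is the change of variables `f_θ`, whose Jacobian `|sin θ|` cancels against the
prefactor; hence it only relabels outcomes.

The statistics of `G S` in `ρ` have density `tr[ρ W(x) S W(x)*] / 2π`. Since Weyl operators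
conjugate each other up to a character, the symplectic Fourier transform of this density is `tr[ρ
W(y)] tr[S W(-y)]` (`integral_tr_mul_orbit_mul_phase`). So two states have the same statistics
exactly when these products agree for all `y`.

If `tr[S W]` has full support, the factor can be cancelled on a dense set; continuity then gives
equal Weyl transforms, and these determine the state. If `tr[S W]` vanishes on a ball, it also
vanishes on the reflected ball. Take a real integrable `ν ≠ 0` whose transform lives on these two
balls. The mixtures of `|W(x)φ⟩⟨W(x)φ|` with weights proportional to `|ν| + ν` and `|ν| - ν` are
distinct states whose difference is invisible to `G S`. -/

theorem exists_isSelfAdjoint_mul_self_eq {E : Type*} [NormedAddCommGroup E]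
    [InnerProductSpace ℂ E] [CompleteSpace E] {T : E →L[ℂ] E} (hT : T.IsPositive) :
    ∃ R : E →L[ℂ] E, IsSelfAdjoint R ∧ R * R = T :=
  ⟨CFC.sqrt T, IsSelfAdjoint.of_nonneg (CFC.sqrt_nonneg T),
    CFC.sqrt_mul_sqrt_self T ((ContinuousLinearMap.nonneg_iff_isPositive T).2 hT)⟩

instance : SecondCountableTopology H :=
  haveI : Fact ((2 : ENNReal) ≠ ⊤) := ⟨ENNReal.ofNat_ne_top⟩
  inferInstance

/-- Orthonormal vectors lie at distance `√2`, so balls of radius `1/2` around them are disjoint, and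
`L²` is separable. Countability is what permits termwise integration later. -/
theorem countable_basisIndex : Countable basisIndex := by
  have hb := basis.orthonormal
  refine (Set.PairwiseDisjoint.countable_of_isOpen (ι := basisIndex)
    (s := fun i => Metric.ball (basis i) (1 / 2)) (a := Set.univ) ?_
    (fun _ _ => Metric.isOpen_ball) (fun i _ => ⟨basis i, by simp⟩)) |> Set.countable_univ_iff.1
  intro i _ j _ hij
  refine Metric.ball_disjoint_ball ?_
  have h : ‖basis i - basis j‖ ^ 2 = 2 := by
    rw [@norm_sub_sq ℂ, hb.1, hb.1, hb.2 hij]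
    norm_num
  rw [dist_eq_norm]
  nlinarith [norm_nonneg (basis i - basis j)]

instance : Countable basisIndex := countable_basisIndex

/-- The vectors `r i` decompose `ρ` as `∑ᵢ |rᵢ⟩⟨rᵢ|`. -/
structure IsDecomposition (ρ : H →L[ℂ] H) (r : basisIndex → H) : Prop where
  norm_sq : HasSum (fun i => ‖r i‖ ^ 2) 1
  trace : ∀ A : H →L[ℂ] H, HasSum (fun i => inner ℂ (r i) (A (r i))) (tr (ρ * A))
  matrix : ∀ φ ψ : H, HasSum (fun i => inner ℂ φ (r i) * inner ℂ (r i) ψ) (inner ℂ φ (ρ ψ))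

theorem hasSum_norm_inner_basis_sq {ι E : Type*} [NormedAddCommGroup E] [InnerProductSpace ℂ E]
    (b : HilbertBasis ι ℂ E) (φ : E) :
    HasSum (fun i => ‖inner ℂ φ (b i)‖ ^ 2) (‖φ‖ ^ 2) := by
  have h := b.hasSum_inner_mul_inner φ φ
  rw [inner_self_eq_norm_sq_to_K] at h
  have h2 := h.mapL Complex.reCLM
  convert h2 using 1
  · ext i
    rw [← inner_conj_symm (b i) φ, Complex.mul_conj, Complex.normSq_eq_norm_sq]
    exact (Complex.ofReal_re _).symm
  · simp [← Complex.ofReal_pow]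

theorem summable_norm_inner_sq {ι E : Type*} [NormedAddCommGroup E] [InnerProductSpace ℂ E]
    (b : HilbertBasis ι ℂ E) {v : ι → E} (hv : Summable fun i => ‖v i‖ ^ 2) :
    Summable fun k : ι × ι => ‖inner ℂ (v k.1) (b k.2)‖ ^ 2 := by
  have h0 : 0 ≤ fun k : ι × ι => ‖inner ℂ (v k.1) (b k.2)‖ ^ 2 := fun k => sq_nonneg _
  refine (summable_prod_of_nonneg h0).2
    ⟨fun i => (hasSum_norm_inner_basis_sq b (v i)).summable, ?_⟩
  simpa only [(hasSum_norm_inner_basis_sq b _).tsum_eq] using hv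

/-- Cyclicity of the trace for a positive trace class operator `R * R` and a bounded operator. -/
theorem hasSum_inner_apply_of_mul_self {ι E : Type*} [NormedAddCommGroup E]
    [InnerProductSpace ℂ E] [CompleteSpace E] (b : HilbertBasis ι ℂ E) {R : E →L[ℂ] E}
    (hR : ∀ φ ψ, inner ℂ (R φ) ψ = inner ℂ φ (R ψ))
    (hn : Summable fun i => ‖R (b i)‖ ^ 2) (A : E →L[ℂ] E) :
    HasSum (fun i => inner ℂ (R (b i)) (A (R (b i))))
      (∑' i, inner ℂ (b i) (R (R (A (b i))))) := by
  -- Summing over the second index first gives the trace, summing over the first index first gives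
  -- `∑ⱼ ⟨R bⱼ, A R bⱼ⟩`. The double family is absolutely summable because both factors are square
  -- summable.
  set f : ι × ι → ℂ := fun k =>
    inner ℂ (R (b k.1)) (b k.2) * inner ℂ (b k.2) (R (A (b k.1))) with hf
  set B := ContinuousLinearMap.adjoint A
  have hsum1 := summable_norm_inner_sq b hn
  have hsum2 := summable_norm_inner_sq b (v := fun i => B (R (b i))) <| by
    refine Summable.of_nonneg_of_le (fun _ => by positivity) (fun i => ?_)
      (hn.mul_left (‖B‖ ^ 2))
    rw [← mul_pow]
    gcongr
    exact B.le_opNorm _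
  have hf2 : ∀ k, f k = inner ℂ (R (b k.1)) (b k.2) * inner ℂ (B (R (b k.2))) (b k.1) :=
    fun k => by
      simp only [hf, B]
      rw [← hR, ContinuousLinearMap.adjoint_inner_left]
  have hfs : Summable f := by
    refine Summable.of_norm_bounded (hsum1.add hsum2.prod_symm) fun k => ?_
    rw [hf2, norm_mul]
    simp only [Prod.swap]
    set u := ‖inner ℂ (R (b k.1)) (b k.2)‖
    set v := ‖inner ℂ (B (R (b k.2))) (b k.1)‖
    nlinarith [sq_nonneg (u - v), sq_nonneg (u + v)]
  have h1 := hfs.hasSum.prod_fiberwise fun i =>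
    b.hasSum_inner_mul_inner (R (b i)) (R (A (b i)))
  have h2 := hfs.prod_symm.hasSum.prod_fiberwise
    (g := fun j => inner ℂ (R (b j)) (A (R (b j)))) fun j => by
    have := b.hasSum_inner_mul_inner (B (R (b j))) (R (b j))
    rw [ContinuousLinearMap.adjoint_inner_left] at this
    refine this.congr_fun fun i => ?_
    rw [hf2, mul_comm, Prod.swap, hR]
  have e : ∑' k, f k = ∑' i, inner ℂ (b i) (R (R (A (b i)))) := by
    rw [← h1.tsum_eq]
    exact tsum_congr fun i => hR _ _
  have e2 : ∑' k : ι × ι, f k.swap = ∑' k, f k := (Equiv.prodComm ι ι).tsum_eq f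
  rwa [e2, e] at h2

/-- The vectors are `√ρ eᵢ`: Parseval gives the matrix elements, cyclicity the traces. -/
theorem IsState.exists_isDecomposition {ρ : H →L[ℂ] H} (hρ : IsState ρ) :
    ∃ r, IsDecomposition ρ r := by
  obtain ⟨R, hR, hRR⟩ := exists_isSelfAdjoint_mul_self_eq hρ.1
  have hin (φ ψ : H) : inner ℂ (R φ) ψ = inner ℂ φ (R ψ) := by
    rw [← ContinuousLinearMap.adjoint_inner_left, hR.adjoint_eq]
  have hρR (φ : H) : ρ φ = R (R φ) := by rw [← hRR]; rfl
  have hs : Summable fun i => inner ℂ (basis i) (ρ (basis i)) := by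
    -- A divergent series would have the default sum `0`, not `1`.
    by_contra h
    have htr := hρ.2
    rw [tr, tsum_eq_zero_of_not_summable h] at htr
    exact zero_ne_one htr
  have hn : HasSum (fun i => ‖R (basis i)‖ ^ 2) 1 := by
    have h := hs.hasSum.mapL Complex.reCLM
    have h1 : (∑' i, inner ℂ (basis i) (ρ (basis i))) = 1 := hρ.2
    rw [h1, Complex.reCLM_apply, Complex.one_re] at h
    convert h using 2 with i
    rw [hρR, ← hin, inner_self_eq_norm_sq_to_K]
    simp [← Complex.ofReal_pow]
  refine ⟨fun i => R (basis i), hn, fun A => ?_, fun φ ψ => ?_⟩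
  · have h := hasSum_inner_apply_of_mul_self basis hin hn.summable A
    simp only [← hρR] at h
    exact h
  · have := basis.hasSum_inner_mul_inner (R φ) (R ψ)
    rw [hin, ← hρR] at this
    refine this.congr_fun fun i => ?_
    rw [hin, hin]

/-! ### Weyl operators -/

theorem coeFn_translation (q : ℝ) (ψ : H) : translation q ψ =ᵐ[volume] fun x => ψ (x - q) :=
  Lp.coeFn_compMeasurePreserving ψ (measurePreserving_sub_right volume q)

theorem coeFn_modulation (p : ℝ) (ψ : H) :
    modulation p ψ =ᵐ[volume] fun x => exp (I * p * x) * ψ x :=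
  MemLp.coeFn_toLp (memLp_modulation p ψ)

theorem ae_eq_comp_sub {f g : ℝ → ℂ} (h : f =ᵐ[volume] g) (q : ℝ) :
    (fun x => f (x - q)) =ᵐ[volume] fun x => g (x - q) :=
  (measurePreserving_sub_right volume q).quasiMeasurePreserving.ae_eq_comp h

theorem translation_mul_translation (a b : ℝ) :
    translation a * translation b = translation (a + b) := by
  ext1 ψ
  refine Lp.ext ?_
  filter_upwards [coeFn_translation a (translation b ψ), coeFn_translation (a + b) ψ,
    ae_eq_comp_sub (coeFn_translation b ψ) a] with x h1 h2 h3
  rw [mul_apply_eq_comp, h1, h2, h3, sub_sub]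

theorem modulation_mul_modulation (a b : ℝ) :
    modulation a * modulation b = modulation (a + b) := by
  ext1 ψ
  refine Lp.ext ?_
  filter_upwards [coeFn_modulation a (modulation b ψ), coeFn_modulation (a + b) ψ,
    coeFn_modulation b ψ] with x h1 h2 h3
  rw [mul_apply_eq_comp, h1, h2, h3, ← mul_assoc, ← Complex.exp_add]
  push_cast
  ring_nf

theorem modulation_mul_translation (p q : ℝ) :
    modulation p * translation q = exp (I * (p * q)) • (translation q * modulation p) := by
  ext1 ψ
  refine Lp.ext ?_
  filter_upwards [coeFn_modulation p (translation q ψ), coeFn_translation q ψ,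
    Lp.coeFn_smul (exp (I * (p * q))) (translation q (modulation p ψ)),
    coeFn_translation q (modulation p ψ), ae_eq_comp_sub (coeFn_modulation p ψ) q]
    with x h1 h2 h3 h4 h5
  rw [mul_apply_eq_comp, h1, h2, smul_apply, mul_apply_eq_comp, h3,
    Pi.smul_apply, h4, h5, smul_eq_mul, ← mul_assoc, ← Complex.exp_add]
  push_cast
  ring_nf

theorem norm_translation_apply (q : ℝ) (ψ : H) : ‖translation q ψ‖ = ‖ψ‖ :=
  LinearIsometry.norm_map _ ψ

theorem norm_exp_I_mul_ofReal (a : ℝ) : ‖exp (I * a)‖ = 1 := by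
  rw [mul_comm, Complex.norm_exp_ofReal_mul_I]

theorem norm_modulation_apply (p : ℝ) (ψ : H) : ‖modulation p ψ‖ = ‖ψ‖ := by
  have h : ∀ᵐ x : ℝ, ‖modulation p ψ x‖ = ‖ψ x‖ := by
    filter_upwards [coeFn_modulation p ψ] with x hx
    rw [hx, norm_mul, mul_assoc, ← ofReal_mul, norm_exp_I_mul_ofReal, one_mul]
  exact le_antisymm (Lp.norm_le_norm_of_ae_le (h.mono fun x hx => hx.le))
    (Lp.norm_le_norm_of_ae_le (h.mono fun x hx => hx.ge))

theorem norm_weyl_apply (x : ℝ × ℝ) (ψ : H) : ‖weyl x ψ‖ = ‖ψ‖ := by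
  rw [weyl, smul_apply, norm_smul, mul_apply_eq_comp,
    norm_translation_apply, norm_modulation_apply]
  have := norm_exp_I_mul_ofReal (x.1 * x.2 / 2)
  push_cast at this
  rw [this, one_mul]

theorem inner_weyl_weyl (x : ℝ × ℝ) (φ ψ : H) :
    inner ℂ (weyl x φ) (weyl x ψ) = inner ℂ φ ψ :=
  (LinearMap.norm_map_iff_inner_map_map (weyl x)).1 (norm_weyl_apply x) φ ψ

theorem modulation_zero : modulation 0 = 1 := by
  ext1 ψ
  refine Lp.ext ?_
  filter_upwards [coeFn_modulation 0 ψ] with x hx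
  rw [hx]
  simp

theorem translation_zero : translation 0 = 1 := by
  ext1 ψ
  refine Lp.ext ?_
  filter_upwards [coeFn_translation 0 ψ] with x hx
  rw [hx]
  simp

theorem weyl_zero : weyl 0 = 1 := by
  simp [weyl, modulation_zero, translation_zero]

theorem weyl_mul_weyl (x y : ℝ × ℝ) :
    weyl x * weyl y = exp (I * ((x.2 * y.1 - x.1 * y.2) / 2)) • weyl (x + y) := by
  have h : translation x.1 * modulation x.2 * (translation y.1 * modulation y.2) =
      exp (I * (x.2 * y.1)) • (translation (x.1 + y.1) * modulation (x.2 + y.2)) := by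
    calc translation x.1 * modulation x.2 * (translation y.1 * modulation y.2)
        = translation x.1 * (modulation x.2 * translation y.1) * modulation y.2 := by
          simp only [mul_assoc]
      _ = _ := by
          rw [modulation_mul_translation, mul_smul_comm, smul_mul_assoc, ← mul_assoc (translation x.1),
            translation_mul_translation, mul_assoc, modulation_mul_modulation]
  simp only [weyl]
  rw [smul_mul_smul_comm, h, smul_smul, smul_smul, ← Complex.exp_add, ← Complex.exp_add,
    ← Complex.exp_add, Prod.fst_add, Prod.snd_add]
  push_cast
  ring_nf

theorem weyl_mul_weyl_neg (x : ℝ × ℝ) : weyl x * weyl (-x) = 1 := by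
  rw [weyl_mul_weyl, add_neg_cancel, weyl_zero]
  simp [mul_comm]

theorem weyl_weyl_neg_apply (x : ℝ × ℝ) (ψ : H) : weyl x (weyl (-x) ψ) = ψ := by
  rw [← mul_apply_eq_comp, weyl_mul_weyl_neg, one_apply_eq_self]

theorem inner_weyl_left (x : ℝ × ℝ) (φ ψ : H) :
    inner ℂ (weyl x φ) ψ = inner ℂ φ (weyl (-x) ψ) := by
  rw [← inner_weyl_weyl x φ, weyl_weyl_neg_apply]

theorem inner_weyl_right (x : ℝ × ℝ) (φ ψ : H) :
    inner ℂ φ (weyl x ψ) = inner ℂ (weyl (-x) φ) ψ := by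
  rw [inner_weyl_left, neg_neg]

theorem adjoint_weyl (x : ℝ × ℝ) : ContinuousLinearMap.adjoint (weyl x) = weyl (-x) := by
  refine ((ContinuousLinearMap.eq_adjoint_iff _ _).2 fun φ ψ => ?_).symm
  rw [inner_weyl_left, neg_neg]

/-- The symplectic character `e^{i (x₁ y₂ - x₂ y₁)}`. -/
def phase (x y : ℝ × ℝ) : ℂ := exp (I * ((x.1 * y.2 - x.2 * y.1 : ℝ) : ℂ))

theorem norm_phase (x y : ℝ × ℝ) : ‖phase x y‖ = 1 := norm_exp_I_mul_ofReal _

theorem continuous_phase (y : ℝ × ℝ) : Continuous fun x => phase x y := by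
  unfold phase
  fun_prop

theorem conj_phase (x y : ℝ × ℝ) : conj (phase x y) = phase x (-y) := by
  rw [phase, phase, ← Complex.exp_conj, map_mul, conj_I, conj_ofReal]
  congr 1
  simp only [Prod.fst_neg, Prod.snd_neg]
  push_cast
  ring

/-- Conjugation by a Weyl operator multiplies Weyl operators by a character. -/
theorem weyl_conj_weyl_apply (x y : ℝ × ℝ) (ψ : H) :
    weyl y (weyl x (weyl (-y) ψ)) = phase x y • weyl x ψ := by
  have h : weyl y * weyl x = phase x y • (weyl x * weyl y) := by
    rw [weyl_mul_weyl, weyl_mul_weyl, smul_smul, phase, ← Complex.exp_add, add_comm y x]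
    congr 2
    push_cast
    ring
  have h2 := congrArg (fun T : H →L[ℂ] H => T (weyl (-y) ψ)) h
  simpa only [mul_apply_eq_comp, smul_apply, weyl_weyl_neg_apply] using h2

/-! ### Strong continuity -/

/-- For isometries weak continuity implies strong continuity, since `‖M_p ψ - M_p₀ ψ‖² = 2‖ψ‖² - 2
Re⟨M_p₀ ψ, M_p ψ⟩`. The inner product is continuous by dominated convergence with bound `‖ψ(x)‖²`.
-/
theorem continuous_modulation_apply (ψ : H) : Continuous fun p => modulation p ψ := by
  refine continuous_iff_continuousAt.2 fun p₀ => ?_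
  have hc : Continuous fun p => inner ℂ (modulation p₀ ψ) (modulation p ψ) := by
    have e (p : ℝ) : inner ℂ (modulation p₀ ψ) (modulation p ψ) =
        ∫ x : ℝ, inner ℂ (exp (I * p₀ * x) * ψ x) (exp (I * p * x) * ψ x) := by
      rw [L2.inner_def]
      refine integral_congr_ae ?_
      filter_upwards [coeFn_modulation p₀ ψ, coeFn_modulation p ψ] with x h1 h2
      rw [h1, h2]
    simp only [e]
    refine continuous_of_dominated (bound := fun x => ‖ψ x‖ ^ 2) (fun p => ?_) (fun p => ?_) ?_ ?_
    · exact ((memLp_modulation p₀ ψ).1).inner (memLp_modulation p ψ).1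
    · refine .of_forall fun x => (norm_inner_le_norm _ _).trans_eq ?_
      rw [norm_mul, norm_mul, mul_assoc I, mul_assoc I, ← ofReal_mul, ← ofReal_mul,
        norm_exp_I_mul_ofReal, norm_exp_I_mul_ofReal]
      ring
    · exact (Lp.memLp ψ).integrable_norm_pow two_ne_zero
    · exact .of_forall fun x => by fun_prop
  have h2 : Filter.Tendsto (fun p => ‖modulation p ψ - modulation p₀ ψ‖ ^ 2) (nhds p₀) (nhds 0) := by
    have e (p : ℝ) : ‖modulation p ψ - modulation p₀ ψ‖ ^ 2 =
        2 * ‖ψ‖ ^ 2 - 2 * (inner ℂ (modulation p₀ ψ) (modulation p ψ)).re := by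
      rw [norm_sub_rev, @norm_sub_sq ℂ, norm_modulation_apply, norm_modulation_apply]
      simp only [RCLike.re_eq_complex_re]
      ring
    simp only [e]
    have : Continuous fun p =>
        2 * ‖ψ‖ ^ 2 - 2 * (inner ℂ (modulation p₀ ψ) (modulation p ψ)).re := by fun_prop
    refine this.tendsto' _ _ ?_
    rw [inner_self_eq_norm_sq_to_K, norm_modulation_apply]
    simp [← ofReal_pow]
  have h3 := h2.sqrt
  simp only [Real.sqrt_sq (norm_nonneg _), Real.sqrt_zero] at h3
  exact tendsto_iff_norm_sub_tendsto_zero.2 h3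

theorem continuous_translation_modulation_apply (ψ : H) :
    Continuous fun x : ℝ × ℝ => translation x.1 (modulation x.2 ψ) := by
  have hg : Continuous fun x : ℝ × ℝ => (⟨fun t => t - x.1, by fun_prop⟩ : C(ℝ, ℝ)) := by
    refine ContinuousMap.continuous_of_continuous_uncurry _ ?_
    simp only [Function.uncurry_def, ContinuousMap.coe_mk]
    fun_prop
  exact ((continuous_modulation_apply ψ).comp continuous_snd).compMeasurePreservingLp hg
    (fun x => measurePreserving_sub_right volume x.1) ENNReal.ofNat_ne_top

theorem continuous_weyl_apply (ψ : H) : Continuous fun x => weyl x ψ := by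
  have h := continuous_translation_modulation_apply ψ
  have h2 : Continuous fun x : ℝ × ℝ => exp (I * (x.1 * x.2 / 2)) := by fun_prop
  exact h2.smul h

theorem continuous_inner_weyl (φ ψ : H) : Continuous fun x => inner ℂ φ (weyl x ψ) :=
  continuous_const.inner (continuous_weyl_apply ψ)

theorem norm_inner_weyl_le (x : ℝ × ℝ) (φ ψ : H) :
    ‖inner ℂ φ (weyl x ψ)‖ ≤ ‖φ‖ * ‖ψ‖ := by
  rw [← norm_weyl_apply x ψ]
  exact norm_inner_le_norm _ _

/-! ### Plancherel's theorem for integrable square integrable functions -/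

theorem eLpNorm_two_sq {α : Type*} [MeasurableSpace α] {μ : Measure α} (f : α → ℂ) :
    eLpNorm f 2 μ ^ 2 = ∫⁻ x, ‖f x‖ₑ ^ 2 ∂μ := by
  have h := eLpNorm_nnreal_pow_eq_lintegral (μ := μ) (f := f) (p := 2) two_ne_zero
  simpa using h

open FourierTransform SchwartzMap in
-- The `L²` Fourier transform and the Fourier integral agree when tested against smooth compactly
-- supported functions: on both sides the transform moves onto the test function, by distributional
-- duality and by Fubini respectively.
theorem coeFn_fourier_toLp {F : ℝ → ℂ} (h1 : Integrable F) (h2 : MemLp F 2) :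
    (𝓕 (h2.toLp F) : Lp ℂ 2 (volume : Measure ℝ)) =ᵐ[volume] 𝓕 F := by
  set g : Lp ℂ 2 (volume : Measure ℝ) := 𝓕 (h2.toLp F) with hg
  have hcont : Continuous (𝓕 F) :=
    VectorFourier.fourierIntegral_continuous Real.continuous_fourierChar
      (by exact continuous_inner) h1
  refine ae_eq_of_integral_contDiff_smul_eq ((Lp.memLp g).locallyIntegrable one_le_two)
    hcont.locallyIntegrable fun u hu hcu => ?_
  have hu1 : HasCompactSupport (Complex.ofRealCLM ∘ u) := hcu.comp_left rfl
  have hu2 : ContDiff ℝ (⊤ : ℕ∞) (Complex.ofRealCLM ∘ u) :=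
    Complex.ofRealCLM.contDiff.comp hu
  set v : 𝓢(ℝ, ℂ) := hu1.toSchwartzMap hu2 with hv
  have hvu (x : ℝ) : v x = (u x : ℂ) := rfl
  have e1 : ∫ x, v x • g x = ∫ x, (𝓕 v) x • F x := by
    have := congrArg (fun T : TemperedDistribution ℝ ℂ => T v)
      (Lp.fourier_toTemperedDistribution_eq (h2.toLp F))
    simp only [TemperedDistribution.fourier_apply, Lp.toTemperedDistribution_apply] at this
    rw [hg, ← this]
    refine integral_congr_ae ?_
    filter_upwards [h2.coeFn_toLp] with x hx
    rw [hx]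
  have e2 : ∫ x, (𝓕 (v : ℝ → ℂ)) x • F x = ∫ x, v x • 𝓕 F x := by
    simpa using! (VectorFourier.integral_fourierIntegral_smul_eq_flip (L := innerₗ ℝ)
      Real.continuous_fourierChar continuous_inner (v.integrable) h1)
  have e3 : ∫ x, v x • g x = ∫ x, v x • 𝓕 F x := by
    rw [e1, ← e2, SchwartzMap.fourier_coe]
  simpa [hvu] using e3

open FourierTransform in
theorem lintegral_enorm_fourier_sq {F : ℝ → ℂ} (h1 : Integrable F) (h2 : MemLp F 2) :
    ∫⁻ ξ, ‖𝓕 F ξ‖ₑ ^ 2 = ∫⁻ x, ‖F x‖ₑ ^ 2 := by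
  rw [← eLpNorm_two_sq, ← eLpNorm_two_sq, ← eLpNorm_congr_ae (coeFn_fourier_toLp h1 h2),
    ← Lp.enorm_def]
  have h : ‖(𝓕 (h2.toLp F) : Lp ℂ 2 (volume : Measure ℝ))‖ₑ = ‖h2.toLp F‖ₑ := by
    rw [← ofReal_norm, ← ofReal_norm, Lp.norm_fourier_eq]
  rw [h, Lp.enorm_def, eLpNorm_congr_ae h2.coeFn_toLp]

/-! ### Orthogonality relations -/

open FourierTransform in
-- For fixed `q` the coefficient is, up to a unimodular factor, a Fourier integral in `p`. The
-- frequency `-p / 2π` comes from the normalization `e^{-2πi x ξ}`.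
theorem enorm_inner_weyl (q p : ℝ) (φ χ : H) :
    ‖inner ℂ φ (weyl (q, p) χ)‖ₑ =
      ‖𝓕 (fun x => conj (φ x) * χ (x - q)) (-(2 * Real.pi)⁻¹ * p)‖ₑ := by
  have e : inner ℂ φ (weyl (q, p) χ) = (exp (I * (q * p / 2 : ℝ)) * exp (I * (-(p * q) : ℝ))) *
      𝓕 (fun x => conj (φ x) * χ (x - q)) (-(2 * Real.pi)⁻¹ * p) := by
    rw [Real.fourier_real_eq_integral_exp_smul, L2.inner_def, ← integral_const_mul]
    refine integral_congr_ae ?_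
    filter_upwards [Lp.coeFn_smul (exp (I * (q * p / 2))) (translation q (modulation p χ)),
      coeFn_translation q (modulation p χ), ae_eq_comp_sub (coeFn_modulation p χ) q]
      with x h1 h2 h3
    have h4 : weyl (q, p) χ x = exp (I * (q * p / 2)) * (exp (I * p * (x - q : ℝ)) * χ (x - q)) := by
      rw [← h3, ← h2]
      exact h1
    have h5 : ((-2 * Real.pi * x * (-(2 * Real.pi)⁻¹ * p) : ℝ) : ℂ) = p * x := by
      have : (-2 * Real.pi * x * (-(2 * Real.pi)⁻¹ * p) : ℝ) = p * x := by
        field_simp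
      rw [this, ofReal_mul]
    rw [h4, h5, RCLike.inner_apply, smul_eq_mul]
    have h6 : exp (I * p * (x - q : ℝ)) = exp (I * (-(p * q) : ℝ)) * exp (p * x * I) := by
      rw [← Complex.exp_add]
      push_cast
      ring_nf
    rw [h6]
    push_cast
    ring
  rw [e, enorm_mul, enorm_mul, ← ofReal_norm (exp _), ← ofReal_norm (exp _),
    norm_exp_I_mul_ofReal, norm_exp_I_mul_ofReal]
  simp

theorem lintegral_comp_const_mul (f : ℝ → ENNReal) (hf : Measurable f) {a : ℝ} (ha : a ≠ 0) :
    ∫⁻ p, f (a * p) = ENNReal.ofReal |a⁻¹| * ∫⁻ p, f p := by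
  have h := lintegral_map (μ := volume) hf (measurable_const_mul a)
  rw [← h, Real.map_volume_mul_left ha, lintegral_smul_measure, smul_eq_mul]

/-- Plancherel in `p` for almost every `q`, then Tonelli and translation invariance in `q`.
Rescaling the frequency produces the factor `2π`. -/
theorem lintegral_enorm_inner_weyl_sq (φ χ : H) :
    ∫⁻ x, ‖inner ℂ φ (weyl x χ)‖ₑ ^ 2 =
      ENNReal.ofReal (2 * Real.pi) * (‖φ‖ₑ ^ 2 * ‖χ‖ₑ ^ 2) := by
  have mφ : Measurable (φ : ℝ → ℂ) := (Lp.stronglyMeasurable φ).measurable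
  have mχ : Measurable (χ : ℝ → ℂ) := (Lp.stronglyMeasurable χ).measurable
  have hc : Continuous fun x => ‖inner ℂ φ (weyl x χ)‖ₑ ^ 2 := by
    have := continuous_inner_weyl φ χ
    fun_prop
  have hm : Measurable (Function.uncurry fun q x : ℝ => ‖conj (φ x) * χ (x - q)‖ₑ ^ 2) := by
    have h1 : Measurable fun z : ℝ × ℝ => conj (φ z.2) :=
      Complex.continuous_conj.measurable.comp (mφ.comp measurable_snd)
    have h2 : Measurable fun z : ℝ × ℝ => χ (z.2 - z.1) :=
      mχ.comp (measurable_snd.sub measurable_fst)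
    exact (h1.mul h2).enorm.pow_const 2
  have hF : ∫⁻ q, ∫⁻ x, ‖conj (φ x) * χ (x - q)‖ₑ ^ 2 = ‖φ‖ₑ ^ 2 * ‖χ‖ₑ ^ 2 := by
    rw [lintegral_lintegral_swap hm.aemeasurable]
    have e (x : ℝ) : ∫⁻ q, ‖conj (φ x) * χ (x - q)‖ₑ ^ 2 = ‖φ x‖ₑ ^ 2 * ‖χ‖ₑ ^ 2 := by
      simp only [enorm_mul, mul_pow, RCLike.enorm_conj]
      rw [lintegral_const_mul _ (by fun_prop),
        lintegral_sub_left_eq_self (fun q => ‖χ q‖ₑ ^ 2), Lp.enorm_def, eLpNorm_two_sq]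
    simp only [e]
    rw [lintegral_mul_const _ (by fun_prop), ← eLpNorm_two_sq, ← Lp.enorm_def]
  rw [Measure.volume_eq_prod, lintegral_prod _ (by exact hc.aemeasurable), ← hF,
    ← lintegral_const_mul _ hm.lintegral_prod_right]
  -- A product of two `L²` functions is always integrable, but it is square integrable only for
  -- almost every shift `q`.
  have hfin : ∀ᵐ q : ℝ, ∫⁻ x, ‖conj (φ x) * χ (x - q)‖ₑ ^ 2 < ⊤ := by
    refine ae_lt_top hm.lintegral_prod_right ?_
    rw [hF]
    finiteness
  refine lintegral_congr_ae ?_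
  filter_upwards [hfin] with q hq
  have hint : Integrable fun x => conj (φ x) * χ (x - q) := by
    have h1 : MemLp (fun x => conj (φ x)) 2 := (Lp.memLp φ).star
    have h2 : MemLp (fun x => χ (x - q)) 2 :=
      (Lp.memLp χ).comp_measurePreserving (measurePreserving_sub_right volume q)
    exact h1.integrable_mul h2
  have hmem : MemLp (fun x => conj (φ x) * χ (x - q)) 2 := by
    refine ⟨hint.1, ?_⟩
    rw [← eLpNorm_two_sq] at hq
    exact lt_of_not_ge fun h => by simp [top_le_iff.1 h] at hq
  simp only [enorm_inner_weyl]
  have hcont := VectorFourier.fourierIntegral_continuous Real.continuous_fourierChar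
      (L := innerₗ ℝ) (by exact continuous_inner) hint
  rw [lintegral_comp_const_mul
    (fun ξ => ‖FourierTransform.fourier (fun x => conj (φ x) * χ (x - q)) ξ‖ₑ ^ 2)
    (by exact (hcont.enorm.measurable.pow_const 2)) (by simp [Real.pi_ne_zero]),
    lintegral_enorm_fourier_sq hint hmem]
  congr 2
  rw [inv_neg, inv_inv, abs_neg, abs_of_pos Real.two_pi_pos]

theorem memLp_inner_weyl (φ χ : H) : MemLp (fun x => inner ℂ φ (weyl x χ)) 2 := by
  refine ⟨(continuous_inner_weyl φ χ).aestronglyMeasurable, ?_⟩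
  have h := eLpNorm_two_sq (μ := volume) fun x => inner ℂ φ (weyl x χ)
  rw [lintegral_enorm_inner_weyl_sq] at h
  refine lt_of_not_ge fun h' => ?_
  rw [top_le_iff.1 h'] at h
  simp only [ne_eq, OfNat.ofNat_ne_zero, not_false_eq_true, ENNReal.top_pow] at h
  exact absurd h.symm (by finiteness)

theorem integral_norm_inner_weyl_sq (φ χ : H) :
    ∫ x, ‖inner ℂ φ (weyl x χ)‖ ^ 2 = 2 * Real.pi * (‖φ‖ ^ 2 * ‖χ‖ ^ 2) := by
  have hc := continuous_inner_weyl φ χ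
  rw [integral_eq_lintegral_of_nonneg_ae (.of_forall fun x => by positivity)
    (by exact (hc.norm.pow 2).aestronglyMeasurable)]
  have e (z : ℂ) : ENNReal.ofReal (‖z‖ ^ 2) = ‖z‖ₑ ^ 2 := by
    rw [ENNReal.ofReal_pow (norm_nonneg _), ofReal_norm]
  simp only [e]
  rw [lintegral_enorm_inner_weyl_sq, ENNReal.toReal_mul, ENNReal.toReal_mul, ENNReal.toReal_pow,
    ENNReal.toReal_pow, ENNReal.toReal_ofReal Real.two_pi_pos.le, toReal_enorm, toReal_enorm]

theorem memLp_inner_weyl_left (φ χ : H) : MemLp (fun x => inner ℂ (weyl x χ) φ) 2 := by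
  simpa only [Pi.star_def, RCLike.star_def, inner_conj_symm] using (memLp_inner_weyl φ χ).star

theorem integrable_inner_weyl_mul (φ χ χ' φ' : H) :
    Integrable fun x => inner ℂ φ (weyl x χ) * inner ℂ (weyl x χ') φ' :=
  (memLp_inner_weyl φ χ).integrable_mul (memLp_inner_weyl_left φ' χ')

/-- Polarization: `φ + ψ` kills the sum of `D φ ψ` and `D ψ φ`, and `φ + iψ` kills their difference.
-/
theorem eq_zero_of_apply_self_eq_zero {E : Type*} [AddCommGroup E] [Module ℂ E]
    (D : E →ₗ⋆[ℂ] E →ₗ[ℂ] ℂ) (h : ∀ φ, D φ φ = 0) (φ ψ : E) : D φ ψ = 0 := by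
  have h1 := h (φ + ψ)
  have h2 := h (φ + I • ψ)
  simp only [map_add, LinearMap.add_apply, h, map_smul, LinearMap.map_smulₛₗ, smul_eq_mul,
    LinearMap.smul_apply, conj_I, zero_add, add_zero, mul_zero] at h1 h2
  have h3 : I * (D φ ψ - D ψ φ) = 0 := by linear_combination h2
  have h4 : D φ ψ - D ψ φ = 0 := (mul_eq_zero.1 h3).resolve_left I_ne_zero
  linear_combination (h1 + h4) / 2

/-- Polarization in the outer vectors alone; the diagonal case is the norm identity obtained from
Plancherel. -/
theorem integral_inner_weyl_mul_self (φ φ' χ : H) :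
    ∫ x, inner ℂ φ (weyl x χ) * inner ℂ (weyl x χ) φ' =
      2 * Real.pi * (inner ℂ φ φ' * inner ℂ χ χ) := by
  let D : H →ₗ⋆[ℂ] H →ₗ[ℂ] ℂ := LinearMap.mk₂'ₛₗ _ _
    (fun φ φ' => (∫ x, inner ℂ φ (weyl x χ) * inner ℂ (weyl x χ) φ') -
      2 * Real.pi * (inner ℂ φ φ' * inner ℂ χ χ))
    (fun a b c => by
      simp only [inner_add_left, add_mul]
      rw [integral_add (integrable_inner_weyl_mul _ _ _ _) (integrable_inner_weyl_mul _ _ _ _)]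
      ring)
    (fun t a c => by
      simp only [inner_smul_left, mul_assoc]
      rw [integral_const_mul, smul_eq_mul]
      ring)
    (fun a b c => by
      simp only [inner_add_right, mul_add, add_mul]
      rw [integral_add (integrable_inner_weyl_mul _ _ _ _) (integrable_inner_weyl_mul _ _ _ _)]
      ring)
    (fun t a c => by
      simp only [inner_smul_right, mul_left_comm _ t]
      rw [integral_const_mul, smul_eq_mul, RingHom.id_apply]
      ring)
  refine sub_eq_zero.1 (eq_zero_of_apply_self_eq_zero D (fun φ => ?_) φ φ')
  refine sub_eq_zero.2 ?_
  have e (x : ℝ × ℝ) : inner ℂ φ (weyl x χ) * inner ℂ (weyl x χ) φ =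
      ((‖inner ℂ φ (weyl x χ)‖ ^ 2 : ℝ) : ℂ) := by
    rw [← inner_conj_symm (weyl x χ) φ, Complex.mul_conj, Complex.normSq_eq_norm_sq]
  simp only [e]
  rw [integral_complex_ofReal, integral_norm_inner_weyl_sq, inner_self_eq_norm_sq_to_K,
    inner_self_eq_norm_sq_to_K]
  simp

/-- The orthogonality relations of the Weyl operators. -/
theorem integral_inner_weyl_mul (φ χ χ' φ' : H) :
    ∫ x, inner ℂ φ (weyl x χ) * inner ℂ (weyl x χ') φ' =
      2 * Real.pi * (inner ℂ φ φ' * inner ℂ χ' χ) := by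
  -- A second polarization, now in the displaced vectors.
  let D : H →ₗ⋆[ℂ] H →ₗ[ℂ] ℂ := LinearMap.mk₂'ₛₗ _ _
    (fun χ' χ => (∫ x, inner ℂ φ (weyl x χ) * inner ℂ (weyl x χ') φ') -
      2 * Real.pi * (inner ℂ φ φ' * inner ℂ χ' χ))
    (fun a b c => by
      simp only [map_add, inner_add_left, mul_add]
      rw [integral_add (integrable_inner_weyl_mul _ _ _ _) (integrable_inner_weyl_mul _ _ _ _)]
      ring)
    (fun t a c => by
      simp only [map_smul, inner_smul_left, mul_left_comm _ (conj t)]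
      rw [integral_const_mul, smul_eq_mul]
      ring)
    (fun a b c => by
      simp only [map_add, inner_add_right, mul_add, add_mul]
      rw [integral_add (integrable_inner_weyl_mul _ _ _ _) (integrable_inner_weyl_mul _ _ _ _)]
      ring)
    (fun t a c => by
      simp only [map_smul, inner_smul_right, mul_left_comm _ t, mul_assoc]
      rw [integral_const_mul, smul_eq_mul, RingHom.id_apply]
      ring)
  refine sub_eq_zero.1 (eq_zero_of_apply_self_eq_zero D (fun χ => ?_) χ' χ)
  exact sub_eq_zero.2 (integral_inner_weyl_mul_self φ φ' χ)

/-- Cauchy–Schwarz. This bound makes the sums over decompositions absolutely convergent after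
integration. -/
theorem integral_norm_inner_weyl_mul_le (φ χ χ' φ' : H) :
    ∫ x, ‖inner ℂ φ (weyl x χ) * inner ℂ (weyl x χ') φ'‖ ≤
      2 * Real.pi * (‖φ‖ * ‖χ‖ * (‖χ'‖ * ‖φ'‖)) := by
  have h := integral_mul_norm_le_Lp_mul_Lq (μ := volume) Real.HolderConjugate.two_two
    (f := fun x => inner ℂ φ (weyl x χ)) (g := fun x => inner ℂ (weyl x χ') φ')
    (by simpa using memLp_inner_weyl φ χ) (by simpa using memLp_inner_weyl_left φ' χ')
  simp only [norm_mul]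
  refine h.trans_eq ?_
  have e (x : ℝ × ℝ) : ‖inner ℂ (weyl x χ') φ'‖ = ‖inner ℂ φ' (weyl x χ')‖ := norm_inner_symm _ _
  simp only [e, Real.rpow_ofNat]
  rw [integral_norm_inner_weyl_sq, integral_norm_inner_weyl_sq, ← Real.sqrt_eq_rpow,
    ← Real.sqrt_eq_rpow, ← Real.sqrt_mul (by positivity), ← Real.sqrt_sq (by positivity :
      0 ≤ 2 * Real.pi * (‖φ‖ * ‖χ‖ * (‖χ'‖ * ‖φ'‖)))]
  congr 1
  ring

/-! ### Termwise integration -/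

section Termwise

variable {ι α : Type*} [Countable ι] [MeasurableSpace α] {μ : Measure α} {F : ι → α → ℂ}
  {f : α → ℂ}

theorem integrable_of_hasSum (hF : ∀ i, Integrable (F i) μ)
    (hs : Summable fun i => ∫ x, ‖F i x‖ ∂μ) (hf : ∀ x, HasSum (fun i => F i x) (f x)) :
    Integrable f μ := by
  refine ⟨aestronglyMeasurable_of_tendsto_ae Filter.atTop
    (f := fun (t : Finset ι) x => ∑ i ∈ t, F i x)
    (fun t => Finset.aestronglyMeasurable_fun_sum t fun i _ => (hF i).1)
    (.of_forall fun x => hf x), ?_⟩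
  have h1 : ∫⁻ x, ‖f x‖ₑ ∂μ ≤ ∑' i, ∫⁻ x, ‖F i x‖ₑ ∂μ := by
    rw [← lintegral_tsum fun i => (hF i).1.enorm]
    refine lintegral_mono fun x => ?_
    rw [← (hf x).tsum_eq]
    exact enorm_tsum_le_tsum_enorm
  refine h1.trans_lt ?_
  have h2 (i : ι) : ∫⁻ x, ‖F i x‖ₑ ∂μ = ENNReal.ofReal (∫ x, ‖F i x‖ ∂μ) := by
    rw [ofReal_integral_norm_eq_lintegral_enorm (hF i)]
  simp only [h2]
  exact hs.tsum_ofReal_lt_top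

theorem hasSum_setIntegral_of_hasSum (hF : ∀ i, Integrable (F i) μ)
    (hs : Summable fun i => ∫ x, ‖F i x‖ ∂μ) (hf : ∀ x, HasSum (fun i => F i x) (f x))
    (Z : Set α) :
    HasSum (fun i => ∫ x in Z, F i x ∂μ) (∫ x in Z, f x ∂μ) := by
  have h := hasSum_integral_of_summable_integral_norm (μ := μ.restrict Z)
    (fun i => (hF i).restrict) (hs.of_nonneg_of_le
      (fun i => integral_nonneg fun x => norm_nonneg _)
      fun i => setIntegral_le_integral (hF i).norm (.of_forall fun x => norm_nonneg _))
  simpa only [(hf _).tsum_eq] using h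

theorem hasSum_integral_of_hasSum (hF : ∀ i, Integrable (F i) μ)
    (hs : Summable fun i => ∫ x, ‖F i x‖ ∂μ) (hf : ∀ x, HasSum (fun i => F i x) (f x)) :
    HasSum (fun i => ∫ x, F i x ∂μ) (∫ x, f x ∂μ) := by
  simpa using hasSum_setIntegral_of_hasSum hF hs hf Set.univ

end Termwise

/-! ### The phase space observable -/

section Orbit

variable {S : H →L[ℂ] H} {s : basisIndex → H}

theorem inner_orbit (S : H →L[ℂ] H) (x : ℝ × ℝ) (φ ψ : H) :
    inner ℂ φ (orbit S x ψ) = inner ℂ (weyl (-x) φ) (S (weyl (-x) ψ)) := by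
  rw [orbit, adjoint_weyl, mul_apply_eq_comp, mul_apply_eq_comp, inner_weyl_right]

theorem IsDecomposition.hasSum_inner_orbit (hs : IsDecomposition S s) (x : ℝ × ℝ) (φ ψ : H) :
    HasSum (fun j => inner ℂ φ (weyl x (s j)) * inner ℂ (weyl x (s j)) ψ)
      (inner ℂ φ (orbit S x ψ)) := by
  rw [inner_orbit]
  refine (hs.matrix (weyl (-x) φ) (weyl (-x) ψ)).congr_fun fun j => ?_
  rw [inner_weyl_right, inner_weyl_left x (s j)]

theorem IsDecomposition.summable_integral_norm (hs : IsDecomposition S s) (φ ψ : H) :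
    Summable fun j => ∫ x, ‖inner ℂ φ (weyl x (s j)) * inner ℂ (weyl x (s j)) ψ‖ := by
  refine Summable.of_nonneg_of_le (fun j => integral_nonneg fun x => norm_nonneg _)
    (fun j => integral_norm_inner_weyl_mul_le _ _ _ _) ?_
  refine (hs.norm_sq.summable.mul_left (2 * Real.pi * ‖φ‖ * ‖ψ‖)).congr fun j => ?_
  ring

theorem IsDecomposition.integrable_inner_orbit (hs : IsDecomposition S s) (φ ψ : H) :
    Integrable fun x => inner ℂ φ (orbit S x ψ) :=
  integrable_of_hasSum (fun _ => integrable_inner_weyl_mul _ _ _ _)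
    (hs.summable_integral_norm φ ψ) fun x => hs.hasSum_inner_orbit x φ ψ

theorem IsDecomposition.hasSum_setIntegral_inner_orbit (hs : IsDecomposition S s) (φ ψ : H)
    (Z : Set (ℝ × ℝ)) :
    HasSum (fun j => ∫ x in Z, inner ℂ φ (weyl x (s j)) * inner ℂ (weyl x (s j)) ψ)
      (∫ x in Z, inner ℂ φ (orbit S x ψ)) :=
  hasSum_setIntegral_of_hasSum (fun _ => integrable_inner_weyl_mul _ _ _ _)
    (hs.summable_integral_norm φ ψ) (fun x => hs.hasSum_inner_orbit x φ ψ) Z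

/-- Orthogonality gives `2π ⟨φ, ψ⟩ ‖sⱼ‖²` for each term, and `∑ ‖sⱼ‖² = 1`. This is the
normalization of `G S`. -/
theorem IsDecomposition.integral_inner_orbit (hs : IsDecomposition S s) (φ ψ : H) :
    ∫ x, inner ℂ φ (orbit S x ψ) = 2 * Real.pi * inner ℂ φ ψ := by
  have h := hs.hasSum_setIntegral_inner_orbit φ ψ Set.univ
  simp only [Measure.restrict_univ, integral_inner_weyl_mul, inner_self_eq_norm_sq_to_K] at h
  have h2 := (hs.norm_sq.mapL Complex.ofRealCLM).mul_left (2 * Real.pi * inner ℂ φ ψ)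
  refine h.unique ?_
  simp only [ofRealCLM_apply, ofReal_one, mul_one, ofReal_pow] at h2
  exact h2.congr_fun fun j => (mul_assoc _ _ _).symm

theorem IsDecomposition.norm_setIntegral_inner_orbit_le (hs : IsDecomposition S s) (φ ψ : H)
    (Z : Set (ℝ × ℝ)) :
    ‖∫ x in Z, inner ℂ φ (orbit S x ψ)‖ ≤ 2 * Real.pi * ‖φ‖ * ‖ψ‖ := by
  rw [← (hs.hasSum_setIntegral_inner_orbit φ ψ Z).tsum_eq]
  have h := hs.norm_sq.mul_left (2 * Real.pi * ‖φ‖ * ‖ψ‖)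
  rw [mul_one] at h
  refine tsum_of_norm_bounded h fun j => ?_
  refine (norm_integral_le_integral_norm _).trans ?_
  refine (setIntegral_le_integral (integrable_inner_weyl_mul _ _ _ _).norm
    (.of_forall fun x => norm_nonneg _)).trans ?_
  refine (integral_norm_inner_weyl_mul_le _ _ _ _).trans_eq ?_
  ring

theorem IsDecomposition.exists_hasWeakIntegral (hs : IsDecomposition S s) (Z : Set (ℝ × ℝ)) :
    ∃ T, HasWeakIntegral (orbit S) Z T := by
  have hi (φ ψ : H) : IntegrableOn (fun x => inner ℂ φ (orbit S x ψ)) Z :=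
    (hs.integrable_inner_orbit φ ψ).integrableOn
  let D : H →ₗ⋆[ℂ] H →ₗ[ℂ] ℂ := LinearMap.mk₂'ₛₗ _ _
    (fun φ ψ => ∫ x in Z, inner ℂ φ (orbit S x ψ))
    (fun a b c => by
      simp only [inner_add_left]
      exact integral_add (hi _ _) (hi _ _))
    (fun t a c => by
      simp only [inner_smul_left]
      exact integral_const_mul _ _)
    (fun a b c => by
      simp only [map_add, inner_add_right]
      exact integral_add (hi _ _) (hi _ _))
    (fun t a c => by
      simp only [map_smul, inner_smul_right]
      exact integral_const_mul _ _)
  let B : H →L⋆[ℂ] H →L[ℂ] ℂ := D.mkContinuous₂ (2 * Real.pi)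
    fun φ ψ => hs.norm_setIntegral_inner_orbit_le φ ψ Z
  -- The Riesz representative acts in the left slot of the inner product; the adjoint moves it to
  -- the right.
  refine ⟨ContinuousLinearMap.adjoint (InnerProductSpace.continuousLinearMapOfBilin B),
    fun φ ψ => ⟨hi φ ψ, ?_⟩⟩
  rw [ContinuousLinearMap.adjoint_inner_right,
    InnerProductSpace.continuousLinearMapOfBilin_apply]
  rfl

end Orbit

theorem HasWeakIntegral.weakIntegral_eq {F : ℝ × ℝ → (H →L[ℂ] H)} {Z : Set (ℝ × ℝ)}
    {T : H →L[ℂ] H} (h : HasWeakIntegral F Z T) : weakIntegral F Z = T := by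
  have hex : ∃ T, HasWeakIntegral F Z T := ⟨T, h⟩
  rw [weakIntegral, dif_pos hex]
  ext1 ψ
  refine ext_inner_left ℂ fun φ => ?_
  rw [(hex.choose_spec φ ψ).2, (h φ ψ).2]

theorem IsDecomposition.inner_G {S : H →L[ℂ] H} {s : basisIndex → H} (hs : IsDecomposition S s)
    (Z : Set (ℝ × ℝ)) (φ ψ : H) :
    inner ℂ φ (G S Z ψ) = ((1 / (2 * Real.pi) : ℝ) : ℂ) * ∫ x in Z, inner ℂ φ (orbit S x ψ) := by
  obtain ⟨T, hT⟩ := hs.exists_hasWeakIntegral Z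
  rw [G, hT.weakIntegral_eq, smul_apply, inner_smul_right, (hT φ ψ).2]

theorem IsState.isObservable_G {S : H →L[ℂ] H} (hS : IsState S) : IsObservable (G S) := by
  obtain ⟨s, hs⟩ := hS.exists_isDecomposition
  refine ⟨fun Z _ => ?_, ?_, fun Z hZ hd φ ψ => ?_⟩
  · have key (φ : H) : ∃ c : ℝ, 0 ≤ c ∧ inner ℂ φ (G S Z φ) = c := by
      have hp (x : ℝ × ℝ) := (hS.1.conj_adjoint (weyl x)).inner_nonneg_right φ
      refine ⟨1 / (2 * Real.pi) * ∫ x in Z, (inner ℂ φ (orbit S x φ)).re, ?_, ?_⟩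
      · have : 0 ≤ ∫ x in Z, (inner ℂ φ (orbit S x φ)).re :=
          integral_nonneg fun x => (Complex.nonneg_iff.1 (hp x)).1
        positivity
      · rw [hs.inner_G, ofReal_mul, ← integral_complex_ofReal]
        congr 2
        ext x
        exact Complex.ext rfl (Complex.nonneg_iff.1 (hp x)).2.symm
    rw [ContinuousLinearMap.isPositive_iff_complex]
    intro φ
    obtain ⟨c, hc, h⟩ := key φ
    rw [← inner_conj_symm, h]
    simpa using hc
  · ext1 ψ
    refine ext_inner_left ℂ fun φ => ?_
    rw [hs.inner_G, Measure.restrict_univ, hs.integral_inner_orbit, one_apply_eq_self]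
    push_cast
    field_simp
  · simp only [hs.inner_G]
    exact (hasSum_integral_iUnion hZ hd (hs.integrable_inner_orbit φ ψ).integrableOn).mul_left _

/-! ### The tilted observable -/

section Tilt

variable {θ : ℝ} (hθ : θ ∈ Set.Ioo (-Real.pi) 0 ∪ Set.Ioo 0 Real.pi)

theorem det_tilt : LinearMap.det (tilt θ hθ : (ℝ × ℝ) →ₗ[ℝ] (ℝ × ℝ)) = Real.sin θ := by
  rw [← LinearMap.det_toMatrix (Module.Basis.finTwoProd ℝ), Matrix.det_fin_two]
  simp [LinearMap.toMatrix_apply, tilt]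

theorem map_tilt_volume : Measure.map (tilt θ hθ) (volume : Measure (ℝ × ℝ)) =
    ENNReal.ofReal |(Real.sin θ)⁻¹| • volume := by
  have h := Measure.map_linearMap_addHaar_eq_smul_addHaar (volume : Measure (ℝ × ℝ))
    (f := (tilt θ hθ : (ℝ × ℝ) →ₗ[ℝ] (ℝ × ℝ))) (by rw [det_tilt]; exact sin_ne_zero hθ)
  rw [det_tilt] at h
  exact h

theorem measurableEmbedding_tilt : MeasurableEmbedding (tilt θ hθ) :=
  (tilt θ hθ).toContinuousLinearEquiv.toHomeomorph.measurableEmbedding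

theorem setIntegral_comp_tilt_symm (g : ℝ × ℝ → ℂ) (Z : Set (ℝ × ℝ)) :
    ∫ x in Z, g ((tilt θ hθ).symm x) = |Real.sin θ| • ∫ x in tilt θ hθ ⁻¹' Z, g x := by
  have h := (measurableEmbedding_tilt hθ).setIntegral_map (μ := volume)
    (fun x => g ((tilt θ hθ).symm x)) Z
  simp only [LinearEquiv.symm_apply_apply] at h
  have h0 : |Real.sin θ| ≠ 0 := abs_ne_zero.2 (sin_ne_zero hθ)
  rw [← h, map_tilt_volume, Measure.restrict_smul, integral_smul_measure,
    ENNReal.toReal_ofReal (abs_nonneg _), smul_smul, abs_inv, mul_inv_cancel₀ h0, one_smul]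

theorem integrableOn_comp_tilt_symm {g : ℝ × ℝ → ℂ} {Z : Set (ℝ × ℝ)}
    (hg : IntegrableOn g (tilt θ hθ ⁻¹' Z)) :
    IntegrableOn (fun x => g ((tilt θ hθ).symm x)) Z := by
  have h := (measurableEmbedding_tilt hθ).integrableOn_map_iff (μ := volume)
    (f := fun x => g ((tilt θ hθ).symm x)) (s := Z)
  have h1 : IntegrableOn (fun x => g ((tilt θ hθ).symm x)) Z (Measure.map (tilt θ hθ) volume) := by
    refine h.2 ?_
    simpa only [Function.comp_def, LinearEquiv.symm_apply_apply] using hg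
  rw [map_tilt_volume, IntegrableOn, Measure.restrict_smul] at h1
  exact (integrable_smul_measure (by simpa using sin_ne_zero hθ) ENNReal.ofReal_ne_top).1 h1

theorem HasWeakIntegral.tilted {S T : H →L[ℂ] H} {Z : Set (ℝ × ℝ)}
    (hT : HasWeakIntegral (orbit S) (tilt θ hθ ⁻¹' Z) T) :
    HasWeakIntegral (tiltedOrbit θ hθ S) Z (((|Real.sin θ| : ℝ) : ℂ) • T) := fun φ ψ => by
  refine ⟨integrableOn_comp_tilt_symm hθ (hT φ ψ).1, ?_⟩
  rw [smul_apply, inner_smul_right, (hT φ ψ).2]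
  exact (setIntegral_comp_tilt_symm hθ (fun x => inner ℂ φ (orbit S x ψ)) Z).symm

/-- The Jacobian `|sin θ|` of the change of variables cancels the extra factor in the prefactor. -/
theorem tiltedG_eq {S : H →L[ℂ] H} (hS : IsState S) (Z : Set (ℝ × ℝ)) :
    tiltedG θ hθ S Z = G S (tilt θ hθ ⁻¹' Z) := by
  obtain ⟨s, hs⟩ := hS.exists_isDecomposition
  obtain ⟨T, hT⟩ := hs.exists_hasWeakIntegral (tilt θ hθ ⁻¹' Z)
  rw [tiltedG, (hT.tilted hθ).weakIntegral_eq, G, hT.weakIntegral_eq, smul_smul]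
  congr 1
  have h0 : |Real.sin θ| ≠ 0 := abs_ne_zero.2 (sin_ne_zero hθ)
  rw [← ofReal_mul]
  congr 1
  field_simp

theorem isObservable_tiltedG {S : H →L[ℂ] H} (hS : IsState S) :
    IsObservable (tiltedG θ hθ S) := by
  have hG := hS.isObservable_G
  have hm := (measurableEmbedding_tilt hθ).measurable
  refine ⟨fun Z hZ => ?_, ?_, fun Z hZ hd φ ψ => ?_⟩
  · rw [tiltedG_eq hθ hS]
    exact hG.isPositive _ (hm hZ)
  · rw [tiltedG_eq hθ hS, Set.preimage_univ, hG.univ]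
  · simp only [tiltedG_eq hθ hS, Set.preimage_iUnion]
    exact hG.iUnion _ (fun n => hm (hZ n)) (fun i j hij => (hd hij).preimage _) φ ψ

/-- `f_θ` permutes the Borel sets, so both observables have the same effects under different labels.
-/
theorem sameStatistics_tiltedG_iff {S : H →L[ℂ] H} (hS : IsState S) (ρ₁ ρ₂ : H →L[ℂ] H) :
    SameStatistics (tiltedG θ hθ S) ρ₁ ρ₂ ↔ SameStatistics (G S) ρ₁ ρ₂ := by
  have hm := measurableEmbedding_tilt hθ
  refine ⟨fun h Z hZ => ?_, fun h Z hZ => ?_⟩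
  · have h1 := h (tilt θ hθ '' Z) (hm.measurableSet_image.2 hZ)
    rwa [tiltedG_eq hθ hS, Set.preimage_image_eq _ (tilt θ hθ).injective] at h1
  · rw [tiltedG_eq hθ hS]
    exact h _ (hm.measurable hZ)

end Tilt

/-! ### The Weyl transform of a state -/

section WeylTransform

variable {ρ : H →L[ℂ] H} {r : basisIndex → H}

theorem IsDecomposition.norm_inner_weyl_le (_ : IsDecomposition ρ r) (y : ℝ × ℝ)
    (i : basisIndex) : ‖inner ℂ (r i) (weyl y (r i))‖ ≤ ‖r i‖ ^ 2 :=
  (TiltedPhaseSpace.norm_inner_weyl_le y (r i) (r i)).trans_eq (sq _).symm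

theorem IsDecomposition.continuous_tr_mul_weyl (hρ : IsDecomposition ρ r) :
    Continuous fun y => tr (ρ * weyl y) := by
  have h : (fun y => tr (ρ * weyl y)) = fun y => ∑' i, inner ℂ (r i) (weyl y (r i)) :=
    funext fun y => (hρ.trace (weyl y)).tsum_eq.symm
  rw [h]
  exact continuous_tsum (fun i => continuous_inner_weyl _ _) hρ.norm_sq.summable
    fun i y => hρ.norm_inner_weyl_le y i

theorem IsDecomposition.tr_mul_weyl_neg (hρ : IsDecomposition ρ r) (y : ℝ × ℝ) :
    tr (ρ * weyl (-y)) = conj (tr (ρ * weyl y)) := by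
  have h := (hρ.trace (weyl y)).mapL (conjCLE : ℂ →L[ℝ] ℂ)
  refine (hρ.trace (weyl (-y))).unique (h.congr_fun fun i => ?_)
  rw [← inner_weyl_left]
  exact (inner_conj_symm _ _).symm

theorem IsDecomposition.tr_mul_weyl_zero (hρ : IsDecomposition ρ r) : tr (ρ * weyl 0) = 1 := by
  have h := hρ.norm_sq.mapL Complex.ofRealCLM
  rw [ofRealCLM_apply, ofReal_one] at h
  refine (hρ.trace (weyl 0)).unique (h.congr_fun fun i => ?_)
  rw [weyl_zero, one_apply_eq_self, inner_self_eq_norm_sq_to_K]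
  simp

/-- Inversion of the Weyl transform: the orthogonality relations, applied termwise, recover the
matrix elements of `ρ`. -/
theorem IsDecomposition.integral_tr_mul_weyl (hρ : IsDecomposition ρ r) (φ ψ : H) :
    ∫ y, tr (ρ * weyl y) * inner ℂ (weyl y ψ) φ = 2 * Real.pi * inner ℂ ψ (ρ φ) := by
  have h := hasSum_integral_of_hasSum (μ := volume)
    (F := fun i y => inner ℂ (r i) (weyl y (r i)) * inner ℂ (weyl y ψ) φ)
    (fun i => integrable_inner_weyl_mul _ _ _ _) ?_ fun y => (hρ.trace (weyl y)).mul_right _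
  · simp only [integral_inner_weyl_mul] at h
    refine h.unique (((hρ.matrix ψ φ).mul_left _).congr_fun fun i => ?_)
    rw [mul_comm (inner ℂ (r i) φ)]
  · refine Summable.of_nonneg_of_le (fun j => integral_nonneg fun x => norm_nonneg _)
      (fun j => integral_norm_inner_weyl_mul_le _ _ _ _) ?_
    refine (hρ.norm_sq.summable.mul_left (2 * Real.pi * ‖φ‖ * ‖ψ‖)).congr fun j => ?_
    ring

/-- A state is determined by its Weyl transform. -/
theorem IsState.eq_of_tr_mul_weyl_eq {ρ₁ ρ₂ : H →L[ℂ] H} (h₁ : IsState ρ₁) (h₂ : IsState ρ₂)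
    (h : ∀ y, tr (ρ₁ * weyl y) = tr (ρ₂ * weyl y)) : ρ₁ = ρ₂ := by
  obtain ⟨r₁, hr₁⟩ := h₁.exists_isDecomposition
  obtain ⟨r₂, hr₂⟩ := h₂.exists_isDecomposition
  ext1 φ
  refine ext_inner_left ℂ fun ψ => ?_
  have e := hr₁.integral_tr_mul_weyl φ ψ
  simp only [h] at e
  rw [hr₂.integral_tr_mul_weyl] at e
  have hpi : (2 * Real.pi : ℂ) ≠ 0 := by simp [Real.pi_ne_zero]
  exact (mul_left_cancel₀ hpi e).symm

end WeylTransform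

/-! ### Measurement statistics -/

section Statistics

variable {ρ S : H →L[ℂ] H} {r s : basisIndex → H}

theorem IsDecomposition.summable_norm_sq_mul (hρ : IsDecomposition ρ r)
    (hs : IsDecomposition S s) :
    Summable fun k : basisIndex × basisIndex => ‖r k.1‖ ^ 2 * ‖s k.2‖ ^ 2 :=
  hρ.norm_sq.summable.mul_of_nonneg hs.norm_sq.summable (fun _ => sq_nonneg _)
    fun _ => sq_nonneg _

/-- The terms are `|⟨rᵢ, W(x) sⱼ⟩|² ≤ ‖rᵢ‖² ‖sⱼ‖²`, so the iterated sum may be taken over pairs. -/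
theorem IsDecomposition.hasSum_tr_mul_orbit (hρ : IsDecomposition ρ r)
    (hs : IsDecomposition S s) (x : ℝ × ℝ) :
    HasSum (fun k : basisIndex × basisIndex =>
      inner ℂ (r k.1) (weyl x (s k.2)) * inner ℂ (weyl x (s k.2)) (r k.1))
      (tr (ρ * orbit S x)) := by
  have h1 : Summable (fun k : basisIndex × basisIndex =>
      inner ℂ (r k.1) (weyl x (s k.2)) * inner ℂ (weyl x (s k.2)) (r k.1)) := by
    refine Summable.of_norm_bounded (hρ.summable_norm_sq_mul hs) fun k => ?_
    rw [norm_mul, norm_inner_symm (weyl x (s k.2)), ← sq, ← mul_pow]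
    gcongr
    exact TiltedPhaseSpace.norm_inner_weyl_le _ _ _
  have h2 := h1.hasSum.prod_fiberwise fun i => hs.hasSum_inner_orbit x (r i) (r i)
  rw [(hρ.trace (orbit S x)).unique h2]
  exact h1.hasSum

theorem IsDecomposition.summable_integral_norm_mul (hρ : IsDecomposition ρ r)
    (hs : IsDecomposition S s) :
    Summable fun k : basisIndex × basisIndex =>
      ∫ x, ‖inner ℂ (r k.1) (weyl x (s k.2)) * inner ℂ (weyl x (s k.2)) (r k.1)‖ := by
  refine Summable.of_nonneg_of_le (fun j => integral_nonneg fun x => norm_nonneg _)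
    (fun j => integral_norm_inner_weyl_mul_le _ _ _ _) ?_
  refine ((hρ.summable_norm_sq_mul hs).mul_left (2 * Real.pi)).congr fun j => ?_
  ring

theorem IsDecomposition.integrable_tr_mul_orbit (hρ : IsDecomposition ρ r)
    (hs : IsDecomposition S s) : Integrable fun x => tr (ρ * orbit S x) :=
  integrable_of_hasSum (fun _ => integrable_inner_weyl_mul _ _ _ _)
    (hρ.summable_integral_norm_mul hs) (hρ.hasSum_tr_mul_orbit hs)

/-- The statistics of `G S` have the density `tr (ρ * orbit S x) / 2π`. -/
theorem IsDecomposition.tr_mul_G (hρ : IsDecomposition ρ r) (hs : IsDecomposition S s)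
    (Z : Set (ℝ × ℝ)) :
    tr (ρ * G S Z) = ((1 / (2 * Real.pi) : ℝ) : ℂ) * ∫ x in Z, tr (ρ * orbit S x) := by
  have h1 := hasSum_setIntegral_of_hasSum (μ := volume)
    (fun _ => integrable_inner_weyl_mul _ _ _ _)
    (hρ.summable_integral_norm_mul hs) (hρ.hasSum_tr_mul_orbit hs) Z
  have h2 := h1.prod_fiberwise fun i => hs.hasSum_setIntegral_inner_orbit (r i) (r i) Z
  have h3 := hρ.trace (G S Z)
  simp only [hs.inner_G] at h3
  exact h3.unique (h2.mul_left _)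

/-- The character is absorbed through `W(y) W(x) W(-y) = phase x y • W(x)`; orthogonality then
applies to the displaced vectors `W(-y) u` and `W(-y) v`. -/
theorem integral_inner_weyl_mul_phase (u v : H) (y : ℝ × ℝ) :
    ∫ x, inner ℂ u (weyl x v) * inner ℂ (weyl x v) u * phase x y =
      2 * Real.pi * (inner ℂ u (weyl y u) * inner ℂ v (weyl (-y) v)) := by
  rw [inner_weyl_right y u u, ← integral_inner_weyl_mul]
  refine integral_congr_ae (.of_forall fun x => ?_)
  change _ = inner ℂ (weyl (-y) u) (weyl x (weyl (-y) v)) * _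
  rw [← inner_weyl_right, weyl_conj_weyl_apply, inner_smul_right]
  ring

theorem hasSum_mul_of_summable_norm {ι κ : Type*} {f : ι → ℂ} {g : κ → ℂ} {a b : ℂ}
    (hf : HasSum f a) (hg : HasSum g b) (hf' : Summable fun i => ‖f i‖)
    (hg' : Summable fun j => ‖g j‖) : HasSum (fun k : ι × κ => f k.1 * g k.2) (a * b) :=
  hf.mul hg (summable_mul_of_summable_norm hf' hg')

theorem IsDecomposition.summable_norm_inner_weyl (hρ : IsDecomposition ρ r) (y : ℝ × ℝ) :
    Summable fun i => ‖inner ℂ (r i) (weyl y (r i))‖ :=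
  Summable.of_nonneg_of_le (fun _ => norm_nonneg _) (hρ.norm_inner_weyl_le y)
    hρ.norm_sq.summable

/-- The symplectic Fourier transform of the statistics is the product of Weyl transforms. -/
theorem IsDecomposition.integral_tr_mul_orbit_mul_phase (hρ : IsDecomposition ρ r)
    (hs : IsDecomposition S s) (y : ℝ × ℝ) :
    ∫ x, tr (ρ * orbit S x) * phase x y =
      2 * Real.pi * (tr (ρ * weyl y) * tr (S * weyl (-y))) := by
  have h1 := hasSum_integral_of_hasSum (μ := volume)
    (F := fun (k : basisIndex × basisIndex) x =>
      inner ℂ (r k.1) (weyl x (s k.2)) * inner ℂ (weyl x (s k.2)) (r k.1) * phase x y)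
    (fun k => (integrable_inner_weyl_mul _ _ _ _).mul_bdd (c := 1)
      (continuous_phase y).aestronglyMeasurable (.of_forall fun x => (norm_phase x y).le))
    (by simpa only [norm_mul, norm_phase, mul_one] using hρ.summable_integral_norm_mul hs)
    (fun x => (hρ.hasSum_tr_mul_orbit hs x).mul_right _)
  simp only [integral_inner_weyl_mul_phase] at h1
  exact h1.unique ((hasSum_mul_of_summable_norm (hρ.trace (weyl y)) (hs.trace (weyl (-y)))
    (hρ.summable_norm_inner_weyl y) (hs.summable_norm_inner_weyl (-y))).mul_left _)

end Statistics

/-- Equal statistics force the densities to agree almost everywhere, hence so do their symplectic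
Fourier transforms. -/
theorem SameStatistics.tr_mul_weyl_mul_eq {ρ₁ ρ₂ S : H →L[ℂ] H} (h₁ : IsState ρ₁)
    (h₂ : IsState ρ₂) (hS : IsState S) (h : SameStatistics (G S) ρ₁ ρ₂) (y : ℝ × ℝ) :
    tr (ρ₁ * weyl y) * tr (S * weyl (-y)) = tr (ρ₂ * weyl y) * tr (S * weyl (-y)) := by
  obtain ⟨r₁, hr₁⟩ := h₁.exists_isDecomposition
  obtain ⟨r₂, hr₂⟩ := h₂.exists_isDecomposition
  obtain ⟨s, hs⟩ := hS.exists_isDecomposition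
  have hpi : (2 * Real.pi : ℂ) ≠ 0 := by simp [Real.pi_ne_zero]
  have hpi' : ((1 / (2 * Real.pi) : ℝ) : ℂ) ≠ 0 := by simp [Real.pi_ne_zero]
  have hae : (fun x => tr (ρ₁ * orbit S x)) =ᵐ[volume] fun x => tr (ρ₂ * orbit S x) := by
    refine (hr₁.integrable_tr_mul_orbit hs).ae_eq_of_forall_setIntegral_eq _ _
      (hr₂.integrable_tr_mul_orbit hs) fun Z hZ _ => ?_
    have e := h Z hZ
    rw [hr₁.tr_mul_G hs, hr₂.tr_mul_G hs] at e
    exact mul_left_cancel₀ hpi' e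
  refine mul_left_cancel₀ hpi ?_
  rw [← hr₁.integral_tr_mul_orbit_mul_phase hs, ← hr₂.integral_tr_mul_orbit_mul_phase hs]
  refine integral_congr_ae ?_
  filter_upwards [hae] with x hx
  rw [hx]

theorem IsDecomposition.tr_mul_orbit_nonneg {ρ S : H →L[ℂ] H} {r s : basisIndex → H}
    (hρ : IsDecomposition ρ r) (hs : IsDecomposition S s) (x : ℝ × ℝ) :
    0 ≤ tr (ρ * orbit S x) := by
  refine (hρ.hasSum_tr_mul_orbit hs x).nonneg fun k => ?_
  rw [← inner_conj_symm (weyl x (s k.2)) (r k.1), Complex.mul_conj]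
  exact Complex.zero_le_real.2 (Complex.normSq_nonneg _)

/-- The finite measure on phase space with density `tr (ρ * orbit S x)`. -/
def statMeasure (ρ S : H →L[ℂ] H) : Measure (ℝ × ℝ) :=
  volume.withDensity fun x => ENNReal.ofReal (tr (ρ * orbit S x)).re

section StatMeasure

variable {ρ S : H →L[ℂ] H} {r s : basisIndex → H}

theorem IsDecomposition.setIntegral_tr_mul_orbit (hρ : IsDecomposition ρ r)
    (hs : IsDecomposition S s) {Z : Set (ℝ × ℝ)} (hZ : MeasurableSet Z) :
    ∫ x in Z, tr (ρ * orbit S x) = (((statMeasure ρ S) Z).toReal : ℂ) := by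
  have hp := hρ.tr_mul_orbit_nonneg hs
  have hi := hρ.integrable_tr_mul_orbit hs
  rw [statMeasure, withDensity_apply _ hZ, ← integral_eq_lintegral_of_nonneg_ae
    (.of_forall fun x => (Complex.nonneg_iff.1 (hp x)).1) hi.re.1.restrict,
    ← integral_complex_ofReal]
  congr 1
  ext x
  exact Complex.ext rfl (Complex.nonneg_iff.1 (hp x)).2.symm

theorem IsDecomposition.isFiniteMeasure_statMeasure (hρ : IsDecomposition ρ r)
    (hs : IsDecomposition S s) : IsFiniteMeasure (statMeasure ρ S) :=
  isFiniteMeasure_withDensity_ofReal (hρ.integrable_tr_mul_orbit hs).re.2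

/-- The functional `L` is `x ↦ x₁ y₂ - x₂ y₁` with `y = (-L (0, 1), L (1, 0))`, so the
characteristic function is the symplectic Fourier transform. -/
theorem IsDecomposition.charFunDual_statMeasure (hρ : IsDecomposition ρ r)
    (hs : IsDecomposition S s) (L : StrongDual ℝ (ℝ × ℝ)) :
    charFunDual (statMeasure ρ S) L = 2 * Real.pi *
      (tr (ρ * weyl (-L (0, 1), L (1, 0))) * tr (S * weyl (-(-L (0, 1), L (1, 0))))) := by
  have hp := hρ.tr_mul_orbit_nonneg hs
  have hi := hρ.integrable_tr_mul_orbit hs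
  have hm : AEMeasurable fun x => ENNReal.ofReal (tr (ρ * orbit S x)).re :=
    hi.re.1.aemeasurable.ennreal_ofReal
  rw [charFunDual_apply, statMeasure, integral_withDensity_eq_integral_toReal_smul₀ hm (.of_forall fun x => ENNReal.ofReal_lt_top),
    ← hρ.integral_tr_mul_orbit_mul_phase hs]
  congr 1
  ext1 x
  have hx := Complex.nonneg_iff.1 (hp x)
  have e1 : (((tr (ρ * orbit S x)).re : ℝ) : ℂ) = tr (ρ * orbit S x) :=
    Complex.ext rfl hx.2
  have e2 : L x = x.1 * L (1, 0) + x.2 * L (0, 1) := by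
    have : x = x.1 • ((1, 0) : ℝ × ℝ) + x.2 • ((0, 1) : ℝ × ℝ) := by ext <;> simp
    conv_lhs => rw [this]
    rw [map_add, map_smul, map_smul, smul_eq_mul, smul_eq_mul]
  rw [ENNReal.toReal_ofReal hx.1, Complex.real_smul, e1, phase, e2, mul_comm I]
  congr 4
  ring

end StatMeasure

/-- A finite measure is determined by its characteristic function. -/
theorem sameStatistics_of_tr_mul_weyl_mul_eq {ρ₁ ρ₂ S : H →L[ℂ] H} (h₁ : IsState ρ₁)
    (h₂ : IsState ρ₂) (hS : IsState S)
    (h : ∀ y, tr (ρ₁ * weyl y) * tr (S * weyl (-y)) = tr (ρ₂ * weyl y) * tr (S * weyl (-y))) :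
    SameStatistics (G S) ρ₁ ρ₂ := by
  obtain ⟨r₁, hr₁⟩ := h₁.exists_isDecomposition
  obtain ⟨r₂, hr₂⟩ := h₂.exists_isDecomposition
  obtain ⟨s, hs⟩ := hS.exists_isDecomposition
  have := hr₁.isFiniteMeasure_statMeasure hs
  have := hr₂.isFiniteMeasure_statMeasure hs
  have hm : statMeasure ρ₁ S = statMeasure ρ₂ S := by
    refine Measure.ext_of_charFunDual (funext fun L => ?_)
    rw [hr₁.charFunDual_statMeasure hs, hr₂.charFunDual_statMeasure hs, h]
  intro Z hZ
  rw [hr₁.tr_mul_G hs, hr₂.tr_mul_G hs, hr₁.setIntegral_tr_mul_orbit hs hZ,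
    hr₂.setIntegral_tr_mul_orbit hs hZ, hm]

theorem informationallyComplete_G_of_tsupport_eq_univ {S : H →L[ℂ] H} (hS : IsState S)
    (h : tsupport (fun x => tr (S * weyl x)) = Set.univ) : InformationallyComplete (G S) := by
  intro ρ₁ ρ₂ h₁ h₂ hstat
  obtain ⟨r₁, hr₁⟩ := h₁.exists_isDecomposition
  obtain ⟨r₂, hr₂⟩ := h₂.exists_isDecomposition
  obtain ⟨s, hs⟩ := hS.exists_isDecomposition
  refine h₁.eq_of_tr_mul_weyl_eq h₂ fun y => ?_
  have hd : Dense (Function.support fun x => tr (S * weyl x)) := dense_iff_closure_eq.2 h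
  refine congrFun (hr₁.continuous_tr_mul_weyl.ext_on hd hr₂.continuous_tr_mul_weyl
    fun y hy => ?_) y
  -- The sign of `y` is harmless because `tr[S W(-y)]` is the conjugate of `tr[S W(y)]`.
  have hy' : tr (S * weyl (-y)) ≠ 0 := by
    rw [hs.tr_mul_weyl_neg]
    exact (map_ne_zero _).2 hy
  exact mul_right_cancel₀ hy' (hstat.tr_mul_weyl_mul_eq h₁ h₂ hS y)

/-! ### Mixtures of displaced pure states -/

/-- The mixture `∫ w(x) |W(x)φ⟩⟨W(x)φ| dx`. -/
def mixture (w : ℝ × ℝ → ℝ) (φ : H) : H →L[ℂ] H :=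
  ∫ x, (w x : ℂ) • InnerProductSpace.rankOne ℂ (weyl x φ) (weyl x φ)

section Mixture

variable {w : ℝ × ℝ → ℝ}

theorem integrable_mixture (hw : Integrable w) (φ : H) :
    Integrable fun x => (w x : ℂ) • InnerProductSpace.rankOne ℂ (weyl x φ) (weyl x φ) := by
  have hc : Continuous fun x => InnerProductSpace.rankOne ℂ (weyl x φ) (weyl x φ) := by
    have h := continuous_weyl_apply φ
    exact ((ContinuousLinearMap.smulRightL ℂ H H).continuous.comp
      ((innerSL ℂ).continuous.comp h)).clm_apply h
  refine Integrable.smul_bdd (φ := fun x => (w x : ℂ)) hw.ofReal (‖φ‖ * ‖φ‖)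
    hc.aestronglyMeasurable (.of_forall fun x => ?_)
  rw [InnerProductSpace.norm_rankOne, norm_weyl_apply]

theorem inner_mixture (hw : Integrable w) (φ a b : H) :
    inner ℂ a (mixture w φ b) =
      ∫ x, (w x : ℂ) * (inner ℂ a (weyl x φ) * inner ℂ (weyl x φ) b) := by
  have hi := integrable_mixture hw φ
  rw [mixture, ContinuousLinearMap.integral_apply hi, ← integral_inner (hi.apply_continuousLinearMap b)]
  refine integral_congr_ae (.of_forall fun x => ?_)
  simp only [smul_apply, InnerProductSpace.rankOne_apply, inner_smul_right]
  ring

theorem isPositive_mixture (hw : Integrable w) (h0 : ∀ x, 0 ≤ w x) (φ : H) :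
    (mixture w φ).IsPositive := by
  rw [ContinuousLinearMap.isPositive_iff_complex]
  intro ψ
  have h : inner ℂ ψ (mixture w φ ψ) =
      ((∫ x, w x * ‖inner ℂ ψ (weyl x φ)‖ ^ 2 : ℝ) : ℂ) := by
    rw [inner_mixture hw, ← integral_complex_ofReal]
    congr 1
    ext x
    rw [← inner_conj_symm (weyl x φ) ψ, Complex.mul_conj, Complex.normSq_eq_norm_sq, ofReal_mul]
  rw [← inner_conj_symm, h]
  have : 0 ≤ ∫ x, w x * ‖inner ℂ ψ (weyl x φ)‖ ^ 2 :=
    integral_nonneg fun x => mul_nonneg (h0 x) (sq_nonneg _)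
  simpa using this

/-- Dominated convergence for the basis expansion: the bound `uv ≤ u² + v²` is summed by Parseval to
an integrable function of `x`. -/
theorem tr_mixture_mul (hw : Integrable w) (φ : H) (A : H →L[ℂ] H) :
    tr (mixture w φ * A) = ∫ x, (w x : ℂ) * inner ℂ (weyl x φ) (A (weyl x φ)) := by
  set B := ContinuousLinearMap.adjoint A with hB
  have hcW := continuous_weyl_apply φ
  have hsum (x : ℝ × ℝ) : HasSum (fun i => |w x| * (‖inner ℂ (B (weyl x φ)) (basis i)‖ ^ 2 +
      ‖inner ℂ (weyl x φ) (basis i)‖ ^ 2)) (|w x| * (‖B (weyl x φ)‖ ^ 2 + ‖weyl x φ‖ ^ 2)) :=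
    ((hasSum_norm_inner_basis_sq basis _).add (hasSum_norm_inner_basis_sq basis _)).mul_left _
  have h := hasSum_integral_of_dominated_convergence (μ := volume)
    (F := fun i x => (w x : ℂ) * (inner ℂ (basis i) (weyl x φ) * inner ℂ (weyl x φ) (A (basis i))))
    (f := fun x => (w x : ℂ) * inner ℂ (weyl x φ) (A (weyl x φ)))
    (fun i x => |w x| * (‖inner ℂ (B (weyl x φ)) (basis i)‖ ^ 2 +
      ‖inner ℂ (weyl x φ) (basis i)‖ ^ 2)) (fun i => ?_) (fun i => .of_forall fun x => ?_)
      (.of_forall fun x => (hsum x).summable) ?_ (.of_forall fun x => ?_)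
  · rw [← h.tsum_eq, tr]
    refine tsum_congr fun i => ?_
    rw [mul_apply_eq_comp, inner_mixture hw]
  · refine hw.ofReal.1.mul (Continuous.aestronglyMeasurable ?_)
    exact (continuous_const.inner hcW).mul (hcW.inner continuous_const)
  · rw [norm_mul, norm_mul, norm_real, Real.norm_eq_abs, norm_inner_symm (basis i),
      ← ContinuousLinearMap.adjoint_inner_left, ← hB]
    gcongr
    set u := ‖inner ℂ (B (weyl x φ)) (basis i)‖
    set v := ‖inner ℂ (weyl x φ) (basis i)‖
    nlinarith [sq_nonneg (u - v), sq_nonneg (u + v)]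
  · simp only [(hsum _).tsum_eq]
    refine hw.abs.mul_bdd (c := (‖B‖ * ‖φ‖) ^ 2 + ‖φ‖ ^ 2)
      (Continuous.aestronglyMeasurable (by fun_prop)) (.of_forall fun x => ?_)
    rw [Real.norm_of_nonneg (by positivity), norm_weyl_apply]
    gcongr
    rw [← norm_weyl_apply x φ]
    exact B.le_opNorm _
  · refine HasSum.mul_left _ ?_
    have := basis.hasSum_inner_mul_inner (B (weyl x φ)) (weyl x φ)
    rw [ContinuousLinearMap.adjoint_inner_left] at this
    refine this.congr_fun fun i => ?_
    rw [mul_comm, ContinuousLinearMap.adjoint_inner_left]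

theorem tr_mixture (hw : Integrable w) (φ : H) :
    tr (mixture w φ) = ((∫ x, w x) * ‖φ‖ ^ 2 : ℝ) := by
  have h := tr_mixture_mul hw φ 1
  rw [mul_one] at h
  rw [h, ofReal_mul, ← integral_complex_ofReal, ← integral_mul_const]
  congr 1
  ext x
  rw [one_apply_eq_self, inner_self_eq_norm_sq_to_K, norm_weyl_apply]
  simp

/-- Displacing a vector multiplies its Weyl transform by a character, so mixing multiplies it by the
symplectic Fourier transform of the weight. -/
theorem tr_mixture_mul_weyl (hw : Integrable w) (φ : H) (y : ℝ × ℝ) :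
    tr (mixture w φ * weyl y) = (∫ x, (w x : ℂ) * phase x y) * inner ℂ φ (weyl y φ) := by
  rw [tr_mixture_mul hw, ← integral_mul_const]
  congr 1
  ext x
  have h := weyl_conj_weyl_apply y (-x) φ
  rw [neg_neg] at h
  have hp : phase y (-x) = phase x y := by
    simp only [phase, Prod.fst_neg, Prod.snd_neg]
    ring_nf
  rw [inner_weyl_left, h, inner_smul_right, hp, mul_assoc]

end Mixture

/-! ### Integrable functions with localized Fourier transform -/

open FourierTransform SchwartzMap in
-- `u` is the inverse Fourier transform of a smooth bump, hence Schwartz and integrable; the scaling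
-- by `-2π` converts the Fourier convention.
theorem exists_integrable_fourier_eq_bump (c : ℝ) {ε : ℝ} (hε : 0 < ε) :
    ∃ (u : ℝ → ℂ) (g : ℝ → ℝ), Integrable u ∧ (∀ y, 0 ≤ g y) ∧ g c = 1 ∧
      (∀ y, g y ≠ 0 → |y - c| < ε) ∧ ∀ y : ℝ, ∫ t, u t * exp (I * ((t * y : ℝ) : ℂ)) = g y := by
  let g : ContDiffBump c := ⟨ε / 2, ε, by positivity, by linarith⟩
  have hπ : -(2 * Real.pi) ≠ 0 := by simp [Real.pi_ne_zero]
  have hk1 : HasCompactSupport fun ξ : ℝ => ((g (-(2 * Real.pi) * ξ) : ℝ) : ℂ) := by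
    have := g.hasCompactSupport.comp_homeomorph (Homeomorph.mulLeft₀ _ hπ)
    exact this.comp_left (g := ((↑) : ℝ → ℂ)) ofReal_zero
  have hk2 : ContDiff ℝ (⊤ : ℕ∞) fun ξ : ℝ => ((g (-(2 * Real.pi) * ξ) : ℝ) : ℂ) :=
    Complex.ofRealCLM.contDiff.comp (g.contDiff.comp (by fun_prop))
  let k : 𝓢(ℝ, ℂ) := hk1.toSchwartzMap hk2
  have hk (ξ : ℝ) : k ξ = ((g (-(2 * Real.pi) * ξ) : ℝ) : ℂ) := rfl
  refine ⟨⇑(𝓕⁻ k : 𝓢(ℝ, ℂ)), g, (𝓕⁻ k : 𝓢(ℝ, ℂ)).integrable, fun y => g.nonneg,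
    g.one_of_mem_closedBall ?_, fun y hy => ?_, fun y => ?_⟩
  · simp [g.rIn_pos.le]
  · have : y ∈ Function.support g := hy
    rwa [g.support_eq, Metric.mem_ball, Real.dist_eq] at this
  · have h1 : 𝓕 (𝓕⁻ k) = k := fourier_fourierInv_eq k
    have h2 := congrArg (fun f : 𝓢(ℝ, ℂ) => f (-(2 * Real.pi)⁻¹ * y)) h1
    simp only [SchwartzMap.fourier_coe] at h2
    rw [Real.fourier_real_eq_integral_exp_smul, hk] at h2
    have e : -(2 * Real.pi) * (-(2 * Real.pi)⁻¹ * y) = y := by field_simp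
    rw [e] at h2
    rw [← h2]
    congr 1
    ext t
    have e2 : -2 * Real.pi * t * (-(2 * Real.pi)⁻¹ * y) = t * y := by field_simp
    rw [e2, smul_eq_mul, mul_comm I, mul_comm]

/-- The character factors as `e^{i x₁ y₂} e^{-i x₂ y₁}`, so a product of two one-dimensional
functions centred at `y₀.2` and `-y₀.1` works. -/
theorem exists_integrable_integral_phase_eq (y₀ : ℝ × ℝ) {ε : ℝ} (hε : 0 < ε) :
    ∃ (f : ℝ × ℝ → ℂ) (g : ℝ × ℝ → ℝ), Integrable f ∧ (∀ y, 0 ≤ g y) ∧ g y₀ = 1 ∧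
      (∀ y, g y ≠ 0 → y ∈ Metric.ball y₀ ε) ∧ ∀ y, ∫ x, f x * phase x y = g y := by
  obtain ⟨u, g, hu, hg0, hg1, hgs, hug⟩ := exists_integrable_fourier_eq_bump y₀.2 hε
  obtain ⟨v, k, hv, hk0, hk1, hks, hvk⟩ := exists_integrable_fourier_eq_bump (-y₀.1) hε
  refine ⟨fun x => u x.1 * v x.2, fun y => g y.2 * k (-y.1), hu.mul_prod hv,
    fun y => mul_nonneg (hg0 _) (hk0 _), by simp [hg1, hk1], fun y hy => ?_, fun y => ?_⟩
  · have h1 := hgs _ (left_ne_zero_of_mul hy)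
    have h2 := hks _ (right_ne_zero_of_mul hy)
    rw [Metric.mem_ball, Prod.dist_eq, max_lt_iff, Real.dist_eq, Real.dist_eq]
    refine ⟨?_, h1⟩
    rwa [← abs_neg, show -(y.1 - y₀.1) = -y.1 - -y₀.1 by ring]
  · rw [ofReal_mul, ← hug, ← hvk, ← integral_prod_mul, Measure.volume_eq_prod]
    congr 1
    ext x
    rw [mul_mul_mul_comm, ← Complex.exp_add, phase]
    congr 2
    push_cast
    ring

theorem integrable_mul_phase {f : ℝ × ℝ → ℂ} (hf : Integrable f) (y : ℝ × ℝ) :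
    Integrable fun x => f x * phase x y :=
  hf.mul_bdd (c := 1) (continuous_phase y).aestronglyMeasurable
    (.of_forall fun x => (norm_phase x y).le)

theorem integrable_ofReal_mul_phase {w : ℝ × ℝ → ℝ} (hw : Integrable w) (y : ℝ × ℝ) :
    Integrable fun x => (w x : ℂ) * phase x y :=
  integrable_mul_phase hw.ofReal y

/-- Weights of mixtures must be real; passing to the real part symmetrizes the transform under `y ↦
-y`. -/
theorem integral_re_mul_phase {f : ℝ × ℝ → ℂ} (hf : Integrable f) (y : ℝ × ℝ) :
    ∫ x, ((f x).re : ℂ) * phase x y =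
      ((∫ x, f x * phase x y) + conj (∫ x, f x * phase x (-y))) / 2 := by
  have hi : Integrable fun x => conj (f x * phase x (-y)) :=
    (Complex.conjCLE : ℂ →L[ℝ] ℂ).integrable_comp (integrable_mul_phase hf (-y))
  rw [← integral_conj, ← integral_add (integrable_mul_phase hf y) hi, ← integral_div]
  congr 1
  ext x
  rw [Complex.re_eq_add_conj, map_mul, conj_phase, neg_neg]
  ring

/-- A vanishing complex quadratic form would give `W(y) = 0`; as `W(y)` is isometric, the space
would be zero, contradicting `tr S = 1`. -/
theorem IsState.exists_inner_weyl_ne_zero {S : H →L[ℂ] H} (hS : IsState S) (y : ℝ × ℝ) :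
    ∃ φ : H, inner ℂ φ (weyl y φ) ≠ 0 := by
  by_contra! h
  have h0 : (weyl y : H →ₗ[ℂ] H) = 0 := by
    refine (inner_map_self_eq_zero _).1 fun φ => ?_
    rw [← inner_conj_symm]
    exact (map_eq_zero _).2 (h φ)
  have h1 (φ : H) : φ = 0 := by
    have : weyl y φ = 0 := congrArg (fun T : H →ₗ[ℂ] H => T φ) h0
    rw [← norm_eq_zero, ← norm_weyl_apply y, this, norm_zero]
  have h2 : tr S = 0 := by
    simp only [tr, h1 (S _), inner_zero_right, tsum_zero]
  exact one_ne_zero (hS.2.symm.trans h2)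

/-! ### Characterization of informational completeness -/

theorem isState_mixture {w : ℝ × ℝ → ℝ} (hw : Integrable w) (h0 : ∀ x, 0 ≤ w x) {φ : H}
    (h1 : (∫ x, w x) * ‖φ‖ ^ 2 = 1) : IsState (mixture w φ) :=
  ⟨isPositive_mixture hw h0 φ, by rw [tr_mixture hw, h1, ofReal_one]⟩

/-- A real integrable function whose symplectic Fourier transform is concentrated on the zeros
of the Weyl transform of `S` yields two distinct states with the same statistics. -/
theorem not_informationallyComplete_G {S : H →L[ℂ] H} (hS : IsState S) {ν : ℝ × ℝ → ℝ}
    (hν : Integrable ν) (h0 : ∀ y, (∫ x, (ν x : ℂ) * phase x y) * tr (S * weyl (-y)) = 0)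
    {y₀ : ℝ × ℝ} (hy₀ : ∫ x, (ν x : ℂ) * phase x y₀ ≠ 0) :
    ¬ InformationallyComplete (G S) := by
  obtain ⟨s, hs⟩ := hS.exists_isDecomposition
  obtain ⟨φ, hφ⟩ := hS.exists_inner_weyl_ne_zero y₀
  -- At the origin `tr[S W(0)] = 1`, so the transform of `ν` vanishes there; this gives both
  -- mixtures the same trace.
  have hν0 : ∫ x, ν x = 0 := by
    have h := h0 0
    rw [neg_zero, hs.tr_mul_weyl_zero, mul_one] at h
    have hp (x : ℝ × ℝ) : phase x 0 = 1 := by simp [phase]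
    simp only [hp, mul_one] at h
    rw [integral_complex_ofReal] at h
    exact_mod_cast h
  have hφ0 : ‖φ‖ ^ 2 ≠ 0 := by
    intro h
    have : φ = 0 := by simpa using h
    simp [this] at hφ
  have hν1 : ∫ x, |ν x| ≠ 0 := by
    intro h
    have hae := (integral_eq_zero_iff_of_nonneg (fun x => abs_nonneg (ν x)) hν.abs).1 h
    refine hy₀ (integral_eq_zero_of_ae ?_)
    filter_upwards [hae] with x hx
    have : ν x = 0 := abs_eq_zero.1 hx
    simp [this]
  have hν2 : 0 ≤ ∫ x, |ν x| := integral_nonneg fun x => abs_nonneg _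
  -- Because `∫ ν = 0`, this constant gives both mixtures trace one.
  set c : ℝ := ((∫ x, |ν x|) * ‖φ‖ ^ 2)⁻¹
  have hc0 : c ≠ 0 := inv_ne_zero (mul_ne_zero hν1 hφ0)
  have hc1 : 0 ≤ c := by positivity
  have hi₁ : Integrable fun x => c * (|ν x| + ν x) := (hν.abs.add hν).const_mul c
  have hi₂ : Integrable fun x => c * (|ν x| - ν x) := (hν.abs.sub hν).const_mul c
  have h₁ : IsState (mixture (fun x => c * (|ν x| + ν x)) φ) := by
    refine isState_mixture hi₁ (fun x => mul_nonneg hc1 (by linarith [neg_abs_le (ν x)])) ?_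
    rw [integral_const_mul, integral_add hν.abs hν, hν0, add_zero, mul_assoc,
      inv_mul_cancel₀ (mul_ne_zero hν1 hφ0)]
  have h₂ : IsState (mixture (fun x => c * (|ν x| - ν x)) φ) := by
    refine isState_mixture hi₂ (fun x => mul_nonneg hc1 (by linarith [le_abs_self (ν x)])) ?_
    rw [integral_const_mul, integral_sub hν.abs hν, hν0, sub_zero, mul_assoc,
      inv_mul_cancel₀ (mul_ne_zero hν1 hφ0)]
  have hdiff (y : ℝ × ℝ) : tr (mixture (fun x => c * (|ν x| + ν x)) φ * weyl y) -
      tr (mixture (fun x => c * (|ν x| - ν x)) φ * weyl y) =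
        2 * c * (∫ x, (ν x : ℂ) * phase x y) * inner ℂ φ (weyl y φ) := by
    rw [tr_mixture_mul_weyl hi₁, tr_mixture_mul_weyl hi₂, ← sub_mul,
      ← integral_sub (integrable_ofReal_mul_phase hi₁ y) (integrable_ofReal_mul_phase hi₂ y),
      ← integral_const_mul]
    congr 2
    ext x
    push_cast
    ring
  intro hcomplete
  have hstat : SameStatistics (G S) (mixture (fun x => c * (|ν x| + ν x)) φ)
      (mixture (fun x => c * (|ν x| - ν x)) φ) := by
    refine sameStatistics_of_tr_mul_weyl_mul_eq h₁ h₂ hS fun y => sub_eq_zero.1 ?_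
    rw [← sub_mul, hdiff]
    linear_combination (2 * c * inner ℂ φ (weyl y φ)) * h0 y
  have h := hdiff y₀
  rw [hcomplete _ _ h₁ h₂ hstat, sub_self] at h
  exact mul_ne_zero (mul_ne_zero (mul_ne_zero two_ne_zero (ofReal_ne_zero.2 hc0)) hy₀) hφ h.symm

theorem tsupport_eq_univ_of_informationallyComplete_G {S : H →L[ℂ] H} (hS : IsState S)
    (h : InformationallyComplete (G S)) :
    tsupport (fun x => tr (S * weyl x)) = Set.univ := by
  by_contra hne
  obtain ⟨s, hs⟩ := hS.exists_isDecomposition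
  obtain ⟨y₀, hy₀⟩ := (Set.ne_univ_iff_exists_notMem _).1 hne
  obtain ⟨ε, hε, hball⟩ := Metric.isOpen_iff.1 (isClosed_tsupport _).isOpen_compl y₀ hy₀
  have hzero (y : ℝ × ℝ) (hy : y ∈ Metric.ball y₀ ε) : tr (S * weyl y) = 0 :=
    image_eq_zero_of_notMem_tsupport (f := fun x => tr (S * weyl x)) (hball hy)
  obtain ⟨f, g, hf, hg0, hg1, hgs, hfg⟩ := exists_integrable_integral_phase_eq y₀ hε
  have hre (y : ℝ × ℝ) : ∫ x, ((f x).re : ℂ) * phase x y = ((g y + g (-y)) / 2 : ℝ) := by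
    rw [integral_re_mul_phase hf, hfg, hfg, conj_ofReal]
    push_cast
    rfl
  refine not_informationallyComplete_G hS hf.re (y₀ := y₀) (fun y => ?_) ?_ h
  · refine (congrArg (· * tr (S * weyl (-y))) (hre y)).trans ?_
    -- The symmetrized transform lives on the ball and its reflection; conjugation symmetry makes
    -- `tr[S W(-y)]` vanish on both.
    by_cases h1 : g y = 0
    · by_cases h2 : g (-y) = 0
      · simp [h1, h2]
      · simp [hzero _ (hgs _ h2)]
    · simp [hs.tr_mul_weyl_neg, hzero _ (hgs _ h1)]
  · refine (hre y₀).trans_ne (ofReal_ne_zero.2 ?_)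
    rw [hg1]
    -- Nonnegativity of `g` prevents the reflected bump from cancelling `g y₀ = 1`.
    linarith [hg0 (-y₀)]

theorem informationallyComplete_G_iff {S : H →L[ℂ] H} (hS : IsState S) :
    InformationallyComplete (G S) ↔ tsupport (fun x => tr (S * weyl x)) = Set.univ :=
  ⟨tsupport_eq_univ_of_informationallyComplete_G hS,
    informationallyComplete_G_of_tsupport_eq_univ hS⟩

end TiltedPhaseSpace

end

theorem mainTheorem4 (θ : ℝ) (hθ : θ ∈ Set.Ioo (-Real.pi) 0 ∪ Set.Ioo 0 Real.pi)
    (S : TiltedPhaseSpace.H →L[ℂ] TiltedPhaseSpace.H) (hS : TiltedPhaseSpace.IsState S) :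
    -- the defining operator integrals exist, and they define observables
    (∀ Z : Set (ℝ × ℝ), MeasurableSet Z →
      (∃ T, TiltedPhaseSpace.HasWeakIntegral (TiltedPhaseSpace.orbit S) Z T) ∧
      (∃ T, TiltedPhaseSpace.HasWeakIntegral (TiltedPhaseSpace.tiltedOrbit θ hθ S) Z T)) ∧
    TiltedPhaseSpace.IsObservable (TiltedPhaseSpace.G S) ∧
    TiltedPhaseSpace.IsObservable (TiltedPhaseSpace.tiltedG θ hθ S) ∧
    -- `G^S_θ(Z) = G^S(f_θ⁻¹(Z))` for all Borel sets `Z`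
    (∀ Z : Set (ℝ × ℝ), MeasurableSet Z →
      TiltedPhaseSpace.tiltedG θ hθ S Z
        = TiltedPhaseSpace.G S (TiltedPhaseSpace.tilt θ hθ ⁻¹' Z)) ∧
    -- informational equivalence
    TiltedPhaseSpace.InformationallyEquivalent
      (TiltedPhaseSpace.G S) (TiltedPhaseSpace.tiltedG θ hθ S) ∧
    -- informational completeness
    (TiltedPhaseSpace.InformationallyComplete (TiltedPhaseSpace.tiltedG θ hθ S) ↔
      tsupport (fun x : ℝ × ℝ => TiltedPhaseSpace.tr (S * TiltedPhaseSpace.weyl x))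
        = Set.univ) := by
  have hequiv := TiltedPhaseSpace.sameStatistics_tiltedG_iff hθ hS
  obtain ⟨s, hs⟩ := hS.exists_isDecomposition
  refine ⟨fun Z _ => ⟨hs.exists_hasWeakIntegral Z, ?_⟩, hS.isObservable_G,
    TiltedPhaseSpace.isObservable_tiltedG hθ hS,
    fun Z _ => TiltedPhaseSpace.tiltedG_eq hθ hS Z, fun ρ₁ ρ₂ _ _ => (hequiv ρ₁ ρ₂).symm, ?_⟩
  · obtain ⟨T, hT⟩ := hs.exists_hasWeakIntegral (TiltedPhaseSpace.tilt θ hθ ⁻¹' Z)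
    exact ⟨_, hT.tilted hθ⟩
  · rw [← TiltedPhaseSpace.informationallyComplete_G_iff hS]
    simp only [TiltedPhaseSpace.InformationallyComplete, hequiv]
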